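/- **Setting.** Let $n\ge 1$, let $U\subset\mathbb R^n$ be open and bounded, and let $\Omega\subset U$ be a Borel set with topological interior $\operatorname{int}\Omega$ and topological boundary $\partial\Omega$. Let $\mathcal L^n$ be Lebesgue measure and $\mathcal H^{n-1}$ the $(n-1)$-dimensional Hausdorff measure. Let $\operatorname{dist}_\Omega(x)=\inf_{y\in\partial\Omega}|x-y|$ for $x\notin\Omega$, $\operatorname{dist}_\Omega(x)=-\inf_{y\in\partial\Omega}|x-y|$ for $x\in\Omega$ (with $\inf\emptyset=\infty$), and $\Omega_\delta=\{x\in\mathbb R^n:\operatorname{dist}_\Omega(x)<\delta\}$ for $\delta\in\mathbb R$. **Good approximation.** A measurable $\chi:U\to[0,1]$ is a good approximation for $\chi_\Omega$ with approximating sequence $(\chi_k)_{k\ge1}$ if the $\chi_k:U\to[0,1]$ are continuous functions in $W^{1,\infty}(U)$ with compact support in $U$ such that $\chi_k\to\chi$ $\mathcal H^{n-1}$-a.e. on $U$; $\chi_k=1$ on $\Omega_{-1/k}$ and $\chi_k=0$ on $U\setminus\Omega_{1/k}$ for all $k$; and $\liminf_{k\to\infty}\|D\chi_k\|_{L^1(U)}<\infty$.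 **Normal measure.** Let $\mathrm{ba}(U,\mathcal B(U),\mathcal L^n)^n$ be the space of $\nu=(\nu_1,\dots,\nu_n)$ where each $\nu_j$ is a bounded, finitely additive, real-valued set function on the Borel sets of $U$ that vanishes on $\mathcal L^n$-null sets. For a bounded finitely additive $\mu$, let $|\mu|$ be its total variation and $|\mu|^*(A)=\inf\{|\mu|(B): B\supset A \text{ Borel}\}$. A function $f:U\to\mathbb R$ is $\mu$-integrable if there are simple Borel functions $s_k$ with $|\mu|^*(\{|s_k-f|>\varepsilon\})\to0$ for every $\varepsilon>0$ and $\int|s_k-s_l|\,d|\mu|\to0$ as $k,l\to\infty$; then $\int f\,d\mu=\lim_k\int s_k\,d\mu$. A vector field $F=(F_1,\dots,F_n)$ is $\nu$-integrable if each $F_j$ is $\nu_j$-integrable, and $\int F\,d\nu=\sum_j\int F_j\,d\nu_j$. A normal measure of $\Omega$ related to $\chi$ and $(\chi_k)$ is a $\nu\in\mathrm{ba}(U,\mathcal B(U),\mathcal L^n)^n=L^\infty(U,\mathbb R^n)^*$ that is a weak$^*$ cluster point of the sequence of functionals $\Phi\mapsto-\int_U\Phi\cdot D\chi_k\,d\mathcal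 L^n$. Such a $\nu$ is concentrated arbitrarily close to $\partial\Omega$, and therefore $\int_{\partial\Omega}F\,d\nu$ is written for the integral $\int F\,d\nu$ over $U$. **Divergence measure fields.** For $1\le p\le\infty$, $\mathcal{DM}^p(U)$ is the set of $F\in L^p(U,\mathbb R^n)$ for which there is a finite signed Borel measure $\operatorname{div}F$ on $U$ with $\int_U F\cdot D\varphi\,d\mathcal L^n=-\int_U\varphi\,d\operatorname{div}F$ for all $\varphi\in C_c^\infty(U)$. Integrals over $\partial\Omega$ with respect to such a measure are taken over $\partial\Omega\cap U$. **Theorem.** Let $\chi$ be a good approximation for $\chi_\Omega$ with approximating sequence $(\chi_k)$, and let $\nu$ be a related normal measure of $\Omega$. (a) Let $F\in\mathcal{DM}^1(U)$ be $\nu$-integrable. Suppose that for each $\varphi\in L^\infty(U)$ there is a subsequence $(\chi_{k'})$ (which may depend on $\varphi$) with $$\lim_{k'\to\infty}\int_U\varphi F\cdot D\chi_{k'}\,d\mathcal L^n=-\int_{\partial\Omega}\varphi F\,d\nu, \qquad(*)$$ and that $\chi_k\to\chi$ $|\operatorname{div}F|$-a.e. on $\partial\Omega\cap U$. Then, for all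 $\varphi\in W^{1,\infty}(U)$, we have $\varphi F\in\mathcal{DM}^1(U)$, $\varphi F$ is $\nu$-integrable, and $$\int_{\partial\Omega}\chi\,d\operatorname{div}(\varphi F)+\operatorname{div}(\varphi F)(\operatorname{int}\Omega)=\int_{\partial\Omega}\varphi F\,d\nu. \qquad(**)$$ (b) Every $F\in\mathcal{DM}^\infty(U)$ satisfies all assumptions of (a): $F\in\mathcal{DM}^1(U)$, $F$ is $\nu$-integrable, for each $\varphi\in L^\infty(U)$ there is a subsequence with $(*)$, and $\chi_k\to\chi$ $|\operatorname{div}F|$-a.e. on $\partial\Omega\cap U$. Hence $(**)$ holds for all $\varphi\in W^{1,\infty}(U)$. -/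

import Mathlib

open MeasureTheory Filter Topology Set
open scoped ENNReal ContDiff RealInnerProductSpace

noncomputable section

namespace GaussGreen

/-! ### Finitely additive measures on the measurable sets and their integral -/

section FinitelyAdditive

variable {α : Type*} [MeasurableSpace α]

/-- A real-valued finitely additive set function on the σ-algebra of all measurable sets.
(Its values on non-measurable sets are never used.) -/
abbrev FAMeasure (α : Type*) [MeasurableSpace α] : Type _ :=
  AddContent ℝ {A : Set α | MeasurableSet A}

namespace FAMeasure

/-- `μ` is bounded: `sup |μ(A)| < ∞` over all measurable `A`. -/
def IsBounded (μ : FAMeasure α) : Prop :=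
  ∃ C : ℝ, ∀ A, MeasurableSet A → |μ A| ≤ C

/-- The positive part `μ⁺(A) = sup {μ(B) : B ⊆ A measurable}`. -/
def posPart (μ : FAMeasure α) (A : Set α) : ℝ :=
  sSup ((fun B => μ B) '' {B | MeasurableSet B ∧ B ⊆ A})

/-- The negative part `μ⁻(A) = sup {-μ(B) : B ⊆ A measurable}`. -/
def negPart (μ : FAMeasure α) (A : Set α) : ℝ :=
  sSup ((fun B => -μ B) '' {B | MeasurableSet B ∧ B ⊆ A})

/-- The total variation `|μ| = μ⁺ + μ⁻`. -/
def variation (μ : FAMeasure α) (A : Set α) : ℝ :=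
  μ.posPart A + μ.negPart A

/-- The outer measure `|μ|*(A) = inf {|μ|(B) : B ⊇ A measurable}` of the total variation. -/
def outerVariation (μ : FAMeasure α) (A : Set α) : ℝ :=
  sInf (μ.variation '' {B | MeasurableSet B ∧ A ⊆ B})

/-- `μ` is weakly absolutely continuous with respect to the σ-additive measure `m`. -/
def WeaklyAC (μ : FAMeasure α) (m : Measure α) : Prop :=
  ∀ A, MeasurableSet A → m A = 0 → μ A = 0

/-- The integral `∑ y · m(s = y)` of a simple function `s` with respect to a set function `m`. -/
def simpleIntegral (m : Set α → ℝ) (s : SimpleFunc α ℝ) : ℝ :=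
  ∑ y ∈ s.range, y * m (s ⁻¹' {y})

/-- `s k` converges to `f` in measure with respect to `|μ|`. -/
def TendstoInMeas (μ : FAMeasure α) (s : ℕ → SimpleFunc α ℝ) (f : α → ℝ) : Prop :=
  ∀ ε : ℝ, 0 < ε → Tendsto (fun k => μ.outerVariation {x | ε < |s k x - f x|}) atTop (𝓝 0)

/-- `s` is a determining sequence for `f`: it converges to `f` in measure and
`∫ |s k - s l| d|μ| → 0` as `k, l → ∞`. -/
def IsDetermining (μ : FAMeasure α) (f : α → ℝ) (s : ℕ → SimpleFunc α ℝ) : Prop :=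
  μ.TendstoInMeas s f ∧
    Tendsto (fun p : ℕ × ℕ => simpleIntegral μ.variation ((s p.1 - s p.2).map fun y => |y|))
      atTop (𝓝 0)

/-- `f` is integrable with respect to the bounded finitely additive measure `μ`. -/
def Integrable (μ : FAMeasure α) (f : α → ℝ) : Prop :=
  ∃ s : ℕ → SimpleFunc α ℝ, μ.IsDetermining f s

open Classical in
/-- The integral `∫ f dμ`: the limit of `∫ s k dμ` along a determining sequence `s`
(for a bounded `μ` the limit exists and does not depend on the determining sequence);
`0` if `f` is not integrable. -/
def integral (μ : FAMeasure α) (f : α → ℝ) : ℝ :=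
  if h : μ.Integrable f then limUnder atTop fun k => simpleIntegral (fun A => μ A) (h.choose k)
  else 0

end FAMeasure

end FinitelyAdditive

variable {n : ℕ}

/-- `ν = (ν₁, …, νₙ) ∈ ba(U, 𝓑(U), 𝓛ⁿ)ⁿ`. A bounded finitely additive measure on the Borel sets
of `U` that vanishes on Lebesgue null sets is regarded as one on the Borel sets of `ℝⁿ` that
vanishes on every `A` with `𝓛ⁿ(A ∩ U) = 0`. -/
def IsBa (U : Set (EuclideanSpace ℝ (Fin n)))
    (ν : Fin n → FAMeasure (EuclideanSpace ℝ (Fin n))) : Prop :=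
  ∀ j, (ν j).IsBounded ∧ (ν j).WeaklyAC (volume.restrict U)

/-- A vector field is `ν`-integrable if each component `F_j` is `ν_j`-integrable. -/
def VIntegrable (ν : Fin n → FAMeasure (EuclideanSpace ℝ (Fin n)))
    (F : EuclideanSpace ℝ (Fin n) → EuclideanSpace ℝ (Fin n)) : Prop :=
  ∀ j, (ν j).Integrable fun x => F x j

/-- `∫ F dν = ∑ⱼ ∫ F_j dν_j`. For a `ν` whose core is contained in `∂Ω` this is the integral
that is written with domain of integration `∂Ω`: it is the integral over `V ∩ U` for any open
`V ⊇ ∂Ω`, in particular for `V = ℝⁿ`. -/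
def vIntegral (ν : Fin n → FAMeasure (EuclideanSpace ℝ (Fin n)))
    (F : EuclideanSpace ℝ (Fin n) → EuclideanSpace ℝ (Fin n)) : ℝ :=
  ∑ j, (ν j).integral fun x => F x j

/-! ### Weak gradients, `W^{1,∞}(U)` and divergence measures -/

/-- `φ ∈ C_c^∞(U)`. -/
def IsTest (U : Set (EuclideanSpace ℝ (Fin n))) (φ : EuclideanSpace ℝ (Fin n) → ℝ) : Prop :=
  ContDiff ℝ ∞ φ ∧ HasCompactSupport φ ∧ tsupport φ ⊆ U

/-- `G` is the weak gradient of `f` on `U`. -/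
def HasWeakGradient (U : Set (EuclideanSpace ℝ (Fin n))) (f : EuclideanSpace ℝ (Fin n) → ℝ)
    (G : EuclideanSpace ℝ (Fin n) → EuclideanSpace ℝ (Fin n)) : Prop :=
  ∀ φ, IsTest U φ → ∫ x in U, f x • gradient φ x = -∫ x in U, φ x • G x

/-- `f ∈ W^{1,∞}(U)`: both `f` and a weak gradient of `f` belong to `L^∞(U)`. -/
def MemW1Inf (U : Set (EuclideanSpace ℝ (Fin n))) (f : EuclideanSpace ℝ (Fin n) → ℝ) : Prop :=
  MemLp f ⊤ (volume.restrict U) ∧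
    ∃ G, MemLp G ⊤ (volume.restrict U) ∧ HasWeakGradient U f G

open Classical in
/-- The weak gradient `Df` on `U` of a function `f ∈ W^{1,∞}(U)` (unique a.e. on `U`). -/
def weakGradient (U : Set (EuclideanSpace ℝ (Fin n))) (f : EuclideanSpace ℝ (Fin n) → ℝ) :
    EuclideanSpace ℝ (Fin n) → EuclideanSpace ℝ (Fin n) :=
  if h : ∃ G, MemLp G ⊤ (volume.restrict U) ∧ HasWeakGradient U f G then h.choose else 0

/-- The finite signed Borel measure `μ`, carried by `U`, is the distributional divergence
of `F` on `U`. -/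
def IsDivergence (U : Set (EuclideanSpace ℝ (Fin n)))
    (F : EuclideanSpace ℝ (Fin n) → EuclideanSpace ℝ (Fin n))
    (μ : SignedMeasure (EuclideanSpace ℝ (Fin n))) : Prop :=
  μ.variation Uᶜ = 0 ∧
    ∀ φ, IsTest U φ → ∫ x in U, ⟪F x, gradient φ x⟫ = -∫ᵛ x, φ x ∂•μ

/-- `F ∈ 𝓓𝓜^p(U)`: an `L^p` vector field on `U` whose distributional divergence is a signed
Radon measure of finite total variation on `U`. -/
def MemDM (U : Set (EuclideanSpace ℝ (Fin n))) (p : ℝ≥0∞)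
    (F : EuclideanSpace ℝ (Fin n) → EuclideanSpace ℝ (Fin n)) : Prop :=
  MemLp F p (volume.restrict U) ∧ ∃ μ, IsDivergence U F μ

open Classical in
/-- The measure `div F` on `U` (unique if it exists). -/
def divMeasure (U : Set (EuclideanSpace ℝ (Fin n)))
    (F : EuclideanSpace ℝ (Fin n) → EuclideanSpace ℝ (Fin n)) :
    SignedMeasure (EuclideanSpace ℝ (Fin n)) :=
  if h : ∃ μ, IsDivergence U F μ then h.choose else 0

/-! ### Good approximations and normal measures -/

open Classical in
/-- The signed distance to `∂Ω`: `-inf_{y ∈ ∂Ω} |x - y|` for `x ∈ Ω` and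
`inf_{y ∈ ∂Ω} |x - y|` for `x ∉ Ω` (with `inf ∅ = ∞`). -/
def signedBdryDist (Ω : Set (EuclideanSpace ℝ (Fin n))) (x : EuclideanSpace ℝ (Fin n)) : EReal :=
  if x ∈ Ω then -(Metric.infEDist x (frontier Ω) : EReal)
  else (Metric.infEDist x (frontier Ω) : EReal)

/-- The `δ`-neighbourhood `Ω_δ = {x : signedBdryDist Ω x < δ}`, `δ ∈ ℝ`. -/
def nbhd (Ω : Set (EuclideanSpace ℝ (Fin n))) (δ : ℝ) : Set (EuclideanSpace ℝ (Fin n)) :=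
  {x | signedBdryDist Ω x < (δ : EReal)}

/-- `χ` is a good approximation for the characteristic function of `Ω` on `U`, with approximating
sequence `χs`. The sequence starts at index `0`, so `χs k` is the `(k+1)`-st member.
The members are functions, not classes; they are continuous on `U` and, having compact support
in `U`, are regarded as continuous functions on `ℝⁿ` that vanish outside `U`.
The values of `χ` outside `U` are irrelevant. -/
structure IsGoodApproximation (U Ω : Set (EuclideanSpace ℝ (Fin n)))
    (χ : EuclideanSpace ℝ (Fin n) → ℝ) (χs : ℕ → EuclideanSpace ℝ (Fin n) → ℝ) : Prop where
  /-- `χ` is (Lebesgue) measurable on `U` -/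
  aemeasurable : AEMeasurable χ (volume.restrict U)
  mem_Icc : ∀ x ∈ U, χ x ∈ Icc (0 : ℝ) 1
  seq_continuous : ∀ k, Continuous (χs k)
  seq_memW1Inf : ∀ k, MemW1Inf U (χs k)
  seq_mem_Icc : ∀ k, ∀ x ∈ U, χs k x ∈ Icc (0 : ℝ) 1
  seq_hasCompactSupport : ∀ k, HasCompactSupport (χs k)
  seq_tsupport_subset : ∀ k, tsupport (χs k) ⊆ U
  tendsto_ae : ∀ᵐ x ∂((Measure.hausdorffMeasure ((n : ℝ) - 1) :
    Measure (EuclideanSpace ℝ (Fin n))).restrict U),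
      Tendsto (fun k => χs k x) atTop (𝓝 (χ x))
  eq_one : ∀ k : ℕ, ∀ x ∈ U ∩ nbhd Ω (-(1 / ((k : ℝ) + 1))), χs k x = 1
  eq_zero : ∀ k : ℕ, ∀ x ∈ U \ nbhd Ω (1 / ((k : ℝ) + 1)), χs k x = 0
  liminf_lt_top :
    liminf (fun k => eLpNorm (weakGradient U (χs k)) 1 (volume.restrict U)) atTop < ⊤

/-- `ν` is a normal measure related to the approximating sequence `χs`: it belongs to
`ba(U, 𝓑(U), 𝓛ⁿ)ⁿ = L^∞(U, ℝⁿ)*` and is a weak* cluster point of the measures `-Dχₖ 𝓛ⁿ`, that is,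
a cluster point with respect to pointwise convergence of functionals on `L^∞(U, ℝⁿ)`. -/
structure IsNormalMeasure (U : Set (EuclideanSpace ℝ (Fin n)))
    (χs : ℕ → EuclideanSpace ℝ (Fin n) → ℝ)
    (ν : Fin n → FAMeasure (EuclideanSpace ℝ (Fin n))) : Prop where
  isBa : IsBa U ν
  clusterPt : MapClusterPt
    (fun Φ : {Φ : EuclideanSpace ℝ (Fin n) → EuclideanSpace ℝ (Fin n) //
      MemLp Φ ⊤ (volume.restrict U)} => vIntegral ν Φ.1)
    atTop
    (fun (k : ℕ) Φ => -∫ x in U, ⟪Φ.1 x, weakGradient U (χs k) x⟫)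

/-- The limit condition: for each `φ ∈ L^∞(U)` there is a subsequence `χs (κ j)` with
`∫_U φ F · Dχs (κ j) → -∫ φ F dν`. -/
def LimitCondition (U : Set (EuclideanSpace ℝ (Fin n)))
    (χs : ℕ → EuclideanSpace ℝ (Fin n) → ℝ)
    (ν : Fin n → FAMeasure (EuclideanSpace ℝ (Fin n)))
    (F : EuclideanSpace ℝ (Fin n) → EuclideanSpace ℝ (Fin n)) : Prop :=
  ∀ φ : EuclideanSpace ℝ (Fin n) → ℝ, MemLp φ ⊤ (volume.restrict U) →
    ∃ κ : ℕ → ℕ, StrictMono κ ∧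
      Tendsto (fun j => ∫ x in U, ⟪φ x • F x, weakGradient U (χs (κ j)) x⟫) atTop
        (𝓝 (-vIntegral ν fun x => φ x • F x))

/-- `χs k → χ` holds `|div F|`-a.e. on `∂Ω` (that is, on `∂Ω ∩ U`). -/
def TendstoAEBoundary (U Ω : Set (EuclideanSpace ℝ (Fin n)))
    (χ : EuclideanSpace ℝ (Fin n) → ℝ) (χs : ℕ → EuclideanSpace ℝ (Fin n) → ℝ)
    (F : EuclideanSpace ℝ (Fin n) → EuclideanSpace ℝ (Fin n)) : Prop :=
  ∀ᵐ x ∂(divMeasure U F).variation, x ∈ frontier Ω ∩ U →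
    Tendsto (fun k => χs k x) atTop (𝓝 (χ x))

end GaussGreen

end

open GaussGreen

noncomputable section

namespace GaussGreen

/-! ### Finitely additive measures -/

namespace FAMeasure

section

variable {α : Type*} [MeasurableSpace α]

/-! Fix `φ` and put `H = φ F`. The product rule `div H = v div F + (F · Dφ) 𝓛ⁿ`, with `v` the limit
on `U` of mollifications of `φ`, shows that `div H` is a finite measure and `div H ≪ |div F| + 𝓛ⁿ`
(`IsDivergence.exists_smul`). The same rule, applied to `H` and the continuous function `χₖ` and
tested with a cutoff that is 1 near `supp χₖ`, gives `∫ H · Dχₖ = -∫ χₖ d div H`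
(`IsDivergence.integral_inner_weakGradient`).

Now let `k → ∞`. Along a subsequence the left side tends to `-∫ H dν` by the limit condition. On the
right, dominated convergence applies: `χₖ` is eventually 1 at each point of `int Ω` and eventually 0
at each point of `U` off the closure of `Ω`. On `∂Ω ∩ U` it tends to `χ` almost everywhere for `|div
F|` by assumption and for `𝓛ⁿ` because `𝓗ⁿ⁻¹`-null sets are Lebesgue null, hence also for `|div H|`.

For bounded `F`, a weak* cluster point evaluated at the single element `φ F` of `L^∞` is a cluster
point of a real sequence, which yields the subsequence. The convergence on the boundary follows
since `|div F|` vanishes on `𝓗ⁿ⁻¹`-null sets (`MemDM.variation_eq_zero_of_hausdorffMeasure`): a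
compact null set is covered by balls with small `∑ rᵢⁿ⁻¹`, so it has cutoffs with small `∫ |Dψ|`,
and `|∫ ψ d div F| ≤ ‖F‖_∞ ∫ |Dψ|`. -/

theorem sSup_image_union {m : Set α → ℝ}
    (hadd : ∀ A B, MeasurableSet A → MeasurableSet B → Disjoint A B → m (A ∪ B) = m A + m B)
    {C : ℝ} (hC : ∀ A, MeasurableSet A → m A ≤ C) {A B : Set α}
    (hA : MeasurableSet A) (hB : MeasurableSet B) (hAB : Disjoint A B) :
    sSup (m '' {D | MeasurableSet D ∧ D ⊆ A ∪ B}) =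
      sSup (m '' {D | MeasurableSet D ∧ D ⊆ A}) + sSup (m '' {D | MeasurableSet D ∧ D ⊆ B}) := by
  -- Without an upper bound `sSup` would take its default value 0.
  have hbdd : ∀ S : Set α, BddAbove (m '' {D | MeasurableSet D ∧ D ⊆ S}) := by
    rintro S
    refine ⟨C, ?_⟩
    rintro _ ⟨D, hD, rfl⟩
    exact hC D hD.1
  have hne : ∀ S : Set α, (m '' {D | MeasurableSet D ∧ D ⊆ S}).Nonempty :=
    fun S => ⟨m ∅, ∅, ⟨MeasurableSet.empty, empty_subset _⟩, rfl⟩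
  apply le_antisymm
  · refine csSup_le (hne _) ?_
    rintro _ ⟨D, ⟨hD, hDS⟩, rfl⟩
    have : D = (D ∩ A) ∪ (D ∩ B) := by
      rw [← inter_union_distrib_left]; exact (inter_eq_left.2 hDS).symm
    rw [this, hadd _ _ (hD.inter hA) (hD.inter hB)
      (hAB.mono inter_subset_right inter_subset_right)]
    exact add_le_add (le_csSup (hbdd _) ⟨_, ⟨hD.inter hA, inter_subset_right⟩, rfl⟩)
      (le_csSup (hbdd _) ⟨_, ⟨hD.inter hB, inter_subset_right⟩, rfl⟩)
  · rw [← le_sub_iff_add_le]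
    refine csSup_le (hne _) ?_
    rintro _ ⟨D, ⟨hD, hDS⟩, rfl⟩
    rw [le_sub_comm]
    refine csSup_le (hne _) ?_
    rintro _ ⟨D', ⟨hD', hDS'⟩, rfl⟩
    rw [le_sub_iff_add_le, add_comm]
    rw [← hadd _ _ hD hD' (hAB.mono hDS hDS')]
    exact le_csSup (hbdd _) ⟨_, ⟨hD.union hD', union_subset_union hDS hDS'⟩, rfl⟩

theorem sSup_image_nonneg {m : Set α → ℝ} (h0 : m ∅ = 0)
    {C : ℝ} (hC : ∀ A, MeasurableSet A → m A ≤ C) (A : Set α) :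
    0 ≤ sSup (m '' {D | MeasurableSet D ∧ D ⊆ A}) := by
  refine le_csSup ⟨C, ?_⟩ ⟨∅, ⟨MeasurableSet.empty, empty_subset _⟩, h0⟩
  rintro _ ⟨D, hD, rfl⟩
  exact hC D hD.1

variable {μ : FAMeasure α}

theorem union_eq (A B : Set α) (hA : MeasurableSet A) (hB : MeasurableSet B)
    (hAB : Disjoint A B) : μ (A ∪ B) = μ A + μ B :=
  addContent_union' hA hB (hA.union hB) hAB

theorem IsBounded.variation_union (hμ : μ.IsBounded) {A B : Set α}
    (hA : MeasurableSet A) (hB : MeasurableSet B) (hAB : Disjoint A B) :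
    μ.variation (A ∪ B) = μ.variation A + μ.variation B := by
  obtain ⟨C, hC⟩ := hμ
  have h1 := sSup_image_union (m := fun B => μ B) union_eq
    (fun A hA => (abs_le.1 (hC A hA)).2) hA hB hAB
  have h2 := sSup_image_union (m := fun B => -μ B)
    (fun A B hA hB hAB => by rw [union_eq A B hA hB hAB, neg_add])
    (fun A hA => neg_le.1 (abs_le.1 (hC A hA)).1) hA hB hAB
  simp only [variation, posPart, negPart, h1, h2]
  ring

theorem IsBounded.variation_nonneg (hμ : μ.IsBounded) (A : Set α) : 0 ≤ μ.variation A := by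
  obtain ⟨C, hC⟩ := hμ
  exact add_nonneg
    (sSup_image_nonneg (m := fun B => μ B) addContent_empty
      (fun A hA => (abs_le.1 (hC A hA)).2) A)
    (sSup_image_nonneg (m := fun B => -μ B) (by simp)
      (fun A hA => neg_le.1 (abs_le.1 (hC A hA)).1) A)

theorem WeaklyAC.variation_eq_zero {m : Measure α} (hμ : μ.WeaklyAC m) {N : Set α}
    (hN : m N = 0) : μ.variation N = 0 := by
  have hne : ({B | MeasurableSet B ∧ B ⊆ N} : Set (Set α)).Nonempty :=
    ⟨∅, MeasurableSet.empty, empty_subset _⟩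
  have h : ∀ B ∈ {B | MeasurableSet B ∧ B ⊆ N}, μ B = 0 := fun B hB =>
    hμ B hB.1 (measure_mono_null hB.2 hN)
  have h1 : (fun B => μ B) '' {B | MeasurableSet B ∧ B ⊆ N} = {0} := by
    rw [image_congr h, hne.image_const]
  have h2 : (fun B => -μ B) '' {B | MeasurableSet B ∧ B ⊆ N} = {0} := by
    rw [image_congr (g := fun _ => (0 : ℝ)) (fun B hB => by rw [h B hB, neg_zero]),
      hne.image_const]
  simp [variation, posPart, negPart, h1, h2]

theorem IsBounded.outerVariation_nonneg (hμ : μ.IsBounded) (A : Set α) :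
    0 ≤ μ.outerVariation A := by
  apply Real.sInf_nonneg
  rintro _ ⟨B, -, rfl⟩
  exact hμ.variation_nonneg B

/-- A null set can be added to any measurable superset of `B` without changing its variation. This
makes convergence in measure insensitive to changes on null sets. -/
theorem outerVariation_le_of_subset_union {m : Measure α} (hμ : μ.IsBounded) (hac : μ.WeaklyAC m)
    {A B N : Set α} (hN : MeasurableSet N) (hN0 : m N = 0) (hAB : A ⊆ B ∪ N) :
    μ.outerVariation A ≤ μ.outerVariation B := by
  refine le_csInf ⟨_, univ, ⟨MeasurableSet.univ, subset_univ _⟩, rfl⟩ ?_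
  rintro _ ⟨D, ⟨hD, hBD⟩, rfl⟩
  have h1 : μ.variation (D ∪ N \ D) = μ.variation D := by
    rw [hμ.variation_union hD (hN.diff hD) disjoint_sdiff_right,
      hac.variation_eq_zero (measure_mono_null sdiff_subset hN0), add_zero]
  rw [← h1, union_sdiff_self]
  refine csInf_le ⟨0, ?_⟩ ⟨_, ⟨hD.union hN, hAB.trans (union_subset_union_left _ hBD)⟩, rfl⟩
  rintro _ ⟨B, -, rfl⟩
  exact hμ.variation_nonneg B

/-! ### Integrals of simple functions against additive set functions. -/

theorem simpleIntegral_eq_setToSimpleFunc (V : Set α → ℝ) (s : SimpleFunc α ℝ) :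
    simpleIntegral V s =
      SimpleFunc.setToSimpleFunc (fun A => V A • ContinuousLinearMap.id ℝ ℝ) s := by
  simp [simpleIntegral, SimpleFunc.setToSimpleFunc, mul_comm]

/-- The reference measure 0 makes every finiteness and integrability condition of `setToSimpleFunc`
trivial; only additivity of `V` remains. -/
theorem finMeasAdditive_of_union {V : Set α → ℝ}
    (hV : ∀ A B, MeasurableSet A → MeasurableSet B → Disjoint A B → V (A ∪ B) = V A + V B) :
    FinMeasAdditive (0 : Measure α) (fun A => V A • ContinuousLinearMap.id ℝ ℝ) :=
  fun A B hA hB _ _ hAB => by simp only [hV A B hA hB hAB, add_smul]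

theorem simpleIntegral_add {V : Set α → ℝ}
    (hV : ∀ A B, MeasurableSet A → MeasurableSet B → Disjoint A B → V (A ∪ B) = V A + V B)
    (s t : SimpleFunc α ℝ) :
    simpleIntegral V (s + t) = simpleIntegral V s + simpleIntegral V t := by
  simp only [simpleIntegral_eq_setToSimpleFunc]
  exact SimpleFunc.setToSimpleFunc_add _ (finMeasAdditive_of_union hV) integrable_zero_measure
    integrable_zero_measure

theorem simpleIntegral_smul {V : Set α → ℝ}
    (hV : ∀ A B, MeasurableSet A → MeasurableSet B → Disjoint A B → V (A ∪ B) = V A + V B)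
    (c : ℝ) (s : SimpleFunc α ℝ) :
    simpleIntegral V (c • s) = c * simpleIntegral V s := by
  simp only [simpleIntegral_eq_setToSimpleFunc]
  exact SimpleFunc.setToSimpleFunc_smul_real _ (finMeasAdditive_of_union hV) c
    integrable_zero_measure

theorem simpleIntegral_mono {V : Set α → ℝ}
    (hV : ∀ A B, MeasurableSet A → MeasurableSet B → Disjoint A B → V (A ∪ B) = V A + V B)
    (hV0 : ∀ A, 0 ≤ V A) {s t : SimpleFunc α ℝ} (hst : s ≤ t) :
    simpleIntegral V s ≤ simpleIntegral V t := by
  simp only [simpleIntegral_eq_setToSimpleFunc]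
  refine SimpleFunc.setToSimpleFunc_mono (finMeasAdditive_of_union hV) ?_
    integrable_zero_measure integrable_zero_measure hst
  intro A _ _ x hx
  simpa using mul_nonneg (hV0 A) hx

theorem simpleIntegral_nonneg {V : Set α → ℝ} (hV0 : ∀ A, 0 ≤ V A) {s : SimpleFunc α ℝ}
    (hs : ∀ x, 0 ≤ s x) : 0 ≤ simpleIntegral V s := by
  refine Finset.sum_nonneg fun y hy => mul_nonneg ?_ (hV0 _)
  obtain ⟨x, rfl⟩ := SimpleFunc.mem_range.1 hy
  exact hs x

theorem simpleIntegral_const {V : Set α → ℝ}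
    (hV : ∀ A B, MeasurableSet A → MeasurableSet B → Disjoint A B → V (A ∪ B) = V A + V B)
    (c : ℝ) : simpleIntegral V (SimpleFunc.const α c) = c * V univ := by
  have h0 : V ∅ = 0 := by simpa using hV ∅ ∅ .empty .empty (disjoint_empty _)
  rw [simpleIntegral_eq_setToSimpleFunc, SimpleFunc.setToSimpleFunc_const]
  · simp [mul_comm]
  · simp [h0]

/-- Rounding `g` down to a multiple of `ε` leaves finitely many values because `g` is bounded. -/
theorem exists_simpleFunc_abs_sub_le {g : α → ℝ} (hg : Measurable g) {C : ℝ}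
    (hC : ∀ x, |g x| ≤ C) {ε : ℝ} (hε : 0 < ε) :
    ∃ t : SimpleFunc α ℝ, ∀ x, |t x - g x| ≤ ε := by
  have hm : Measurable fun x => (⌊g x / ε⌋ : ℝ) * ε :=
    ((measurable_from_top (f := fun z : ℤ => (z : ℝ))).comp
      (Int.measurable_floor.comp (hg.div_const ε))).mul_const ε
  refine ⟨⟨fun x => (⌊g x / ε⌋ : ℝ) * ε, fun y => hm (measurableSet_singleton y), ?_⟩, ?_⟩
  · refine ((finite_Icc ⌊-C / ε⌋ ⌊C / ε⌋).image fun z : ℤ => (z : ℝ) * ε).subset ?_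
    rintro _ ⟨x, rfl⟩
    refine ⟨⌊g x / ε⌋, ⟨Int.floor_mono ?_, Int.floor_mono ?_⟩, rfl⟩
    · gcongr; exact (abs_le.1 (hC x)).1
    · gcongr; exact (abs_le.1 (hC x)).2
  · intro x
    change |(⌊g x / ε⌋ : ℝ) * ε - g x| ≤ ε
    have h1 : (⌊g x / ε⌋ : ℝ) * ε ≤ g x := (le_div_iff₀ hε).1 (Int.floor_le _)
    have h2 : g x < ((⌊g x / ε⌋ : ℝ) + 1) * ε := (div_lt_iff₀ hε).1 (Int.lt_floor_add_one _)
    rw [abs_le]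
    constructor <;> linarith

theorem tendsto_one_div_add_one_div :
    Tendsto (fun p : ℕ × ℕ => 1 / ((p.1 : ℝ) + 1) + 1 / ((p.2 : ℝ) + 1)) atTop (𝓝 0) := by
  rw [← prod_atTop_atTop_eq]
  simpa using ((tendsto_one_div_add_atTop_nhds_zero_nat (𝕜 := ℝ)).comp tendsto_fst).add
    ((tendsto_one_div_add_atTop_nhds_zero_nat (𝕜 := ℝ)).comp tendsto_snd)

/-- The product of an integrable function with a function that is essentially bounded and
measurable up to a null set is integrable. -/
theorem Integrable.bdd_mul {m : Measure α} (hμ : μ.IsBounded) (hac : μ.WeaklyAC m)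
    {f g g' : α → ℝ} (hf : μ.Integrable f) (hg' : Measurable g') {C : ℝ} (hC : ∀ x, |g' x| ≤ C)
    (hgg' : g =ᵐ[m] g') : μ.Integrable fun x => g x * f x := by
  obtain ⟨s, hs1, hs2⟩ := hf
  have hV := fun A B => hμ.variation_union (A := A) (B := B)
  have hV0 := hμ.variation_nonneg
  have hbd : ∀ k, ∃ D : ℝ, 0 < D ∧ ∀ x, |s k x| ≤ D := by
    intro k
    obtain ⟨D, hD⟩ := ((s k).map fun y => |y|).exists_forall_le
    exact ⟨max D 1, by positivity, fun x => (hD x).trans (le_max_left _ _)⟩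
  choose D hD0 hD using hbd
  -- The tolerance is divided by the bound `D k` of `s k`, so that `t k * s k` stays uniformly
  -- within `1 / (k + 1)` of `g' * s k`.
  have hex : ∀ k : ℕ, ∃ t : SimpleFunc α ℝ, ∀ x, |t x - g' x| ≤ 1 / ((k : ℝ) + 1) / D k :=
    fun k => exists_simpleFunc_abs_sub_le hg' hC (div_pos Nat.one_div_pos_of_nat (hD0 k))
  choose t ht using hex
  have hts : ∀ k x, |t k x * s k x - g' x * s k x| ≤ 1 / ((k : ℝ) + 1) := by
    intro k x
    rw [← sub_mul, abs_mul]
    calc |t k x - g' x| * |s k x| ≤ 1 / ((k : ℝ) + 1) / D k * D k :=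
          mul_le_mul (ht k x) (hD k x) (abs_nonneg _) (div_nonneg (by positivity) (hD0 k).le)
      _ = 1 / ((k : ℝ) + 1) := div_mul_cancel₀ _ (hD0 k).ne'
  have hC0 : ∀ x : α, 0 ≤ C := fun x => (abs_nonneg _).trans (hC x)
  refine ⟨fun k => t k * s k, ?_, ?_⟩
  · intro ε hε
    obtain ⟨N, hN, hNm, hN0⟩ : ∃ N, {x | ¬ g x = g' x} ⊆ N ∧ MeasurableSet N ∧ m N = 0 :=
      exists_measurable_superset_of_null hgg'
    have hε' : 0 < ε / 2 / (|C| + 1) := by positivity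
    have hev : ∀ᶠ k : ℕ in atTop, 1 / ((k : ℝ) + 1) < ε / 2 :=
      tendsto_one_div_add_atTop_nhds_zero_nat.eventually (gt_mem_nhds (half_pos hε))
    refine tendsto_of_tendsto_of_tendsto_of_le_of_le' tendsto_const_nhds (hs1 _ hε')
      (.of_forall fun k => hμ.outerVariation_nonneg _) ?_
    filter_upwards [hev] with k hk
    refine outerVariation_le_of_subset_union hμ hac hNm hN0 ?_
    intro x hx
    by_cases hxN : x ∈ N
    · exact Or.inr hxN
    left
    have hxg : g x = g' x := by
      by_contra h; exact hxN (hN h)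
    simp only [mem_ofPred_eq, SimpleFunc.coe_mul, Pi.mul_apply, hxg] at hx ⊢
    rw [div_lt_iff₀ (by positivity)]
    have h1 := hts k x
    have h2 : |g' x * s k x - g' x * f x| ≤ |s k x - f x| * (|C| + 1) := by
      rw [← mul_sub, abs_mul, mul_comm]
      gcongr
      linarith [hC x, le_abs_self C]
    have h3 := abs_sub_le (t k x * s k x) (g' x * s k x) (g' x * f x)
    linarith
  -- Both products are compared with `g' * s k` and `g' * s l`; the uniform errors cost a multiple
  -- of the finite total variation.
  · have key : ∀ p : ℕ × ℕ, simpleIntegral μ.variation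
        ((t p.1 * s p.1 - t p.2 * s p.2).map fun y => |y|) ≤
        (1 / ((p.1 : ℝ) + 1) + 1 / ((p.2 : ℝ) + 1)) * μ.variation univ +
          C * simpleIntegral μ.variation ((s p.1 - s p.2).map fun y => |y|) := by
      rintro ⟨k, l⟩
      rw [← simpleIntegral_const hV, ← simpleIntegral_smul hV, ← simpleIntegral_add hV]
      refine simpleIntegral_mono hV hV0 fun x => ?_
      simp only [SimpleFunc.coe_map, SimpleFunc.coe_sub, SimpleFunc.coe_mul, Function.comp_apply,
        Pi.sub_apply, Pi.mul_apply, SimpleFunc.coe_add, Pi.add_apply, SimpleFunc.coe_const,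
        Function.const_apply, SimpleFunc.coe_smul, Pi.smul_apply, smul_eq_mul]
      have h1 := hts k x
      have h2 := hts l x
      rw [abs_sub_comm] at h2
      have h3 : |g' x * s k x - g' x * s l x| ≤ C * |s k x - s l x| := by
        rw [← mul_sub, abs_mul]
        gcongr
        exact hC x
      have h4 := abs_sub_le (t k x * s k x) (g' x * s k x) (t l x * s l x)
      have h5 := abs_sub_le (g' x * s k x) (g' x * s l x) (t l x * s l x)
      linarith
    refine tendsto_of_tendsto_of_tendsto_of_le_of_le tendsto_const_nhds ?_
      (fun p => simpleIntegral_nonneg hV0 fun x => abs_nonneg _) key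
    simpa using (tendsto_one_div_add_one_div.mul_const (μ.variation univ)).add (hs2.const_mul C)

/-- Together with `Integrable.bdd_mul` this yields integrability of all essentially bounded
functions that are measurable up to a null set. -/
theorem integrable_one (hμ : μ.IsBounded) : μ.Integrable fun _ => 1 := by
  have h0 : μ.variation ∅ = 0 := by
    simpa using hμ.variation_union .empty .empty (disjoint_empty ∅)
  have h0' : μ.outerVariation ∅ = 0 := by
    refine le_antisymm ?_ (hμ.outerVariation_nonneg _)
    refine csInf_le ⟨0, ?_⟩ ⟨∅, ⟨.empty, Subset.rfl⟩, h0⟩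
    rintro _ ⟨B, -, rfl⟩
    exact hμ.variation_nonneg B
  refine ⟨fun _ => SimpleFunc.const α 1, fun ε hε => ?_, ?_⟩
  · simp [hε.not_gt, h0']
  · have : (((SimpleFunc.const α (1 : ℝ)) - SimpleFunc.const α 1).map fun y => |y|) =
        SimpleFunc.const α 0 := by
      ext; simp
    simp only [this, simpleIntegral_const fun A B => hμ.variation_union (A := A) (B := B)]
    simp

end

end FAMeasure

/-! ### Signed measures with densities -/

section SignedMeasure

variable {X : Type*} [MeasurableSpace X]

theorem isFiniteMeasure_variation (σ : SignedMeasure X) : IsFiniteMeasure σ.variation := by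
  rw [← SignedMeasure.totalVariation_eq_variation]
  infer_instance

theorem integral_toSignedMeasure_smul (m : Measure X) [IsFiniteMeasure m] (f : X → ℝ) :
    ∫ᵛ x, f x ∂•m.toSignedMeasure = ∫ x, f x ∂m := by
  rw [← VectorMeasure.integral_toSignedMeasure]
  congr 1
  ext
  simp

/-- The positive and negative parts of `h` give two finite positive measures, against both of which
the bounded `f` is integrable. -/
theorem integral_withDensityᵥ_smul {m : Measure X} {f h : X → ℝ} (hh : Integrable h m)
    (hf : AEStronglyMeasurable f m) {C : ℝ} (hC : ∀ x, |f x| ≤ C) :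
    ∫ᵛ x, f x ∂•(m.withDensityᵥ h) = ∫ x, f x * h x ∂m := by
  have fin1 := isFiniteMeasure_withDensity_ofReal hh.2
  have fin2 := isFiniteMeasure_withDensity_ofReal hh.neg.2
  have hint : ∀ g : X → ℝ, Integrable g m → Integrable (fun x => f x * g x) m := fun g hg =>
    hg.bdd_mul hf (.of_forall hC)
  have hfi : ∀ m' : Measure X, m' ≪ m → IsFiniteMeasure m' → Integrable f m' := fun m' hm' _ =>
    (integrable_const C).mono' (hf.mono_ac hm') (.of_forall hC)
  have i1 := hfi _ (withDensity_absolutelyContinuous m fun x => ENNReal.ofReal (h x)) fin1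
  have i2 := hfi _ (withDensity_absolutelyContinuous m fun x => ENNReal.ofReal (-h x)) fin2
  rw [withDensityᵥ_eq_withDensity_pos_part_sub_withDensity_neg_part hh,
    VectorMeasure.integral_sub_vectorMeasure
      (by rwa [VectorMeasure.Integrable, Measure.variation_toSignedMeasure])
      (by rwa [VectorMeasure.Integrable, Measure.variation_toSignedMeasure]),
    integral_toSignedMeasure_smul, integral_toSignedMeasure_smul,
    integral_withDensity_eq_integral_toReal_smul₀ hh.aemeasurable.ennreal_ofReal
      (.of_forall fun _ => ENNReal.ofReal_lt_top),
    integral_withDensity_eq_integral_toReal_smul₀ (f := fun x => ENNReal.ofReal (-h x))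
      hh.neg.aemeasurable.ennreal_ofReal (.of_forall fun _ => ENNReal.ofReal_lt_top), ← integral_sub]
  · refine integral_congr_ae (.of_forall fun x => ?_)
    simp only [ENNReal.toReal_ofReal', smul_eq_mul]
    rw [← sub_mul, max_zero_sub_max_neg_zero_eq_self, mul_comm]
  · refine (hint _ hh.pos_part).congr (.of_forall fun x => ?_)
    simp [ENNReal.toReal_ofReal', mul_comm]
  · refine (hint _ hh.neg_part).congr (.of_forall fun x => ?_)
    simp [ENNReal.toReal_ofReal', mul_comm]

/-- Radon–Nikodym for `σ ≪ |σ|`; the product of a bounded function with `σ` can then be written as a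
density. -/
theorem exists_eq_variation_withDensityᵥ (σ : SignedMeasure X) :
    ∃ h, Integrable h σ.variation ∧ σ.variation.withDensityᵥ h = σ := by
  have := isFiniteMeasure_variation σ
  refine ⟨σ.rnDeriv σ.variation, SignedMeasure.integrable_rnDeriv _ _,
    SignedMeasure.withDensityᵥ_rnDeriv_eq _ _ σ.absolutelyContinuous⟩

/-- A signed Borel measure vanishes on `A` if it vanishes on every compact subset of `A`. -/
theorem variation_eq_zero_of_isCompact [TopologicalSpace X] [BorelSpace X] [PolishSpace X] (σ : SignedMeasure X) {A : Set X} (hA : MeasurableSet A)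
    (h : ∀ K ⊆ A, IsCompact K → σ K = 0) : σ.variation A = 0 := by
  have := isFiniteMeasure_variation σ
  rw [VectorMeasure.variation_apply_eq_zero hA]
  intro t htA ht
  by_contra hne
  have hpos : 0 < |σ t| := abs_pos.2 hne
  -- Inner regularity leaves a remainder of variation below `|σ t|`, yet `σ K = 0` forces this
  -- remainder to carry all of `σ t`.
  obtain ⟨K, hKt, hK, hlt⟩ := ht.exists_isCompact_sdiff_lt (μ := σ.variation)
    (measure_ne_top _ _) (ENNReal.ofReal_pos.2 hpos).ne'
  have h1 : σ t = σ (t \ K) := by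
    rw [VectorMeasure.of_sdiff hK.measurableSet ht hKt, h K (hKt.trans htA) hK, sub_zero]
  have h2 : |σ (t \ K)| ≤ (σ.variation (t \ K)).toReal :=
    VectorMeasure.norm_measure_le_variation (μ := σ) (measure_ne_top _ _)
  have h3 := ENNReal.toReal_lt_of_lt_ofReal hlt
  rw [← h1] at h2
  linarith

end SignedMeasure

/-! ### Smooth approximation of functions with bounded weak gradient -/

section Mollification

open scoped Convolution

variable {n : ℕ}

local notation "𝔼" => EuclideanSpace ℝ (Fin n)

/-- A measurable representative is set to 0 off `U` and wherever its norm exceeds the essential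
supremum. The result is defined and bounded everywhere, hence can be mollified. -/
theorem exists_bounded_measurable {X V : Type*} [MeasurableSpace X] {m : Measure X}
    [NormedAddCommGroup V] [MeasurableSpace V] [BorelSpace V] [SecondCountableTopology V]
    {U : Set X} (hU : MeasurableSet U) {φ : X → V} (hφ : MemLp φ ⊤ (m.restrict U)) :
    ∃ (f : X → V) (C : ℝ), Measurable f ∧ (∀ x, ‖f x‖ ≤ C) ∧ (∀ x, x ∉ U → f x = 0) ∧
      φ =ᵐ[m.restrict U] f := by
  set f₀ := hφ.1.mk φ with hf₀
  have hm : Measurable f₀ := hφ.1.stronglyMeasurable_mk.measurable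
  set C := (eLpNorm φ ⊤ (m.restrict U)).toReal with hC
  have hb : ∀ᵐ x ∂m.restrict U, ‖φ x‖ ≤ C := by
    filter_upwards [enorm_ae_le_eLpNormEssSup φ (m.restrict U)] with x hx
    rw [← eLpNorm_exponent_top] at hx
    simpa only [toReal_enorm] using ENNReal.toReal_mono hφ.2.ne hx
  refine ⟨({x | ‖f₀ x‖ ≤ C} ∩ U).indicator f₀, C, hm.indicator
    ((measurableSet_le hm.norm measurable_const).inter hU), fun x => ?_, fun x hx => ?_, ?_⟩
  · by_cases hx : x ∈ {x | ‖f₀ x‖ ≤ C} ∩ U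
    · rw [indicator_of_mem hx]; exact hx.1
    · rw [indicator_of_notMem hx, norm_zero]; exact ENNReal.toReal_nonneg
  · exact indicator_of_notMem (fun h => hx h.2) _
  · filter_upwards [hb, hφ.1.ae_eq_mk, ae_restrict_mem hU] with x h1 h2 h3
    have hx : x ∈ {x | ‖f₀ x‖ ≤ C} ∩ U := ⟨by rw [mem_ofPred_eq, hf₀, ← h2]; exact h1, h3⟩
    rw [indicator_of_mem hx, h2]

theorem locallyIntegrable_of_bounded {X V : Type*} [MeasurableSpace X] [TopologicalSpace X]
    {m : Measure X} [IsLocallyFiniteMeasure m] [NormedAddCommGroup V] {f : X → V}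
    (hf : AEStronglyMeasurable f m) {C : ℝ} (hC : ∀ x, ‖f x‖ ≤ C) : LocallyIntegrable f m :=
  (locallyIntegrable_const C).mono hf (.of_forall fun x => by
    rw [Real.norm_eq_abs]; exact (hC x).trans (le_abs_self C))

theorem norm_normed_convolution_le {V : Type*} [NormedAddCommGroup V] [NormedSpace ℝ V]
    (ρ : ContDiffBump (0 : 𝔼)) {g : 𝔼 → V} {C : ℝ} (hC : ∀ x, ‖g x‖ ≤ C) (x : 𝔼) :
    ‖((ρ.normed volume) ⋆[ContinuousLinearMap.lsmul ℝ ℝ, volume] g) x‖ ≤ C := by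
  have h : ‖((ρ.normed volume) ⋆[ContinuousLinearMap.lsmul ℝ ℝ, volume] g) x‖ ≤
      ∫ t, ρ.normed volume t * C := by
    refine norm_integral_le_of_norm_le (ρ.integrable_normed.mul_const C) (.of_forall fun t => ?_)
    rw [ContinuousLinearMap.lsmul_apply, norm_smul, Real.norm_of_nonneg (ρ.nonneg_normed t)]
    exact mul_le_mul_of_nonneg_left (hC _) (ρ.nonneg_normed t)
  rwa [integral_mul_const, ρ.integral_normed, one_mul] at h

theorem contDiff_normed_convolution (ρ : ContDiffBump (0 : 𝔼)) {f : 𝔼 → ℝ}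
    (hf : LocallyIntegrable f) :
    ContDiff ℝ ∞ ((ρ.normed volume) ⋆[ContinuousLinearMap.lsmul ℝ ℝ, volume] f) :=
  ρ.hasCompactSupport_normed.contDiff_convolution_left _ ρ.contDiff_normed hf

/-- The translated and reflected kernel is the test function that turns the definition of a weak
gradient into a statement on convolutions at `x`. -/
theorem isTest_comp_sub {U : Set 𝔼} (ρ : ContDiffBump (0 : 𝔼)) {x : 𝔼}
    (hx : Metric.closedBall x ρ.rOut ⊆ U) : IsTest U fun y => ρ.normed volume (x - y) := by
  have hs : tsupport (fun y => ρ.normed volume (x - y)) ⊆ Metric.closedBall x ρ.rOut := by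
    refine closure_minimal ?_ Metric.isClosed_closedBall
    intro y hy
    have h : x - y ∈ Function.support (ρ.normed volume) := hy
    rw [ρ.support_normed_eq, mem_ball_zero_iff] at h
    rw [Metric.mem_closedBall, dist_comm, dist_eq_norm]
    exact h.le
  exact ⟨ρ.contDiff_normed.comp (contDiff_const.sub contDiff_id),
    HasCompactSupport.intro' (isCompact_closedBall x ρ.rOut) Metric.isClosed_closedBall
      fun y hy => by_contra fun h => hy (hs (subset_tsupport _ h)), hs.trans hx⟩

theorem norm_gradient (f : 𝔼 → ℝ) (x : 𝔼) : ‖gradient f x‖ = ‖fderiv ℝ f x‖ := by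
  simp [gradient]

theorem _root_.ContDiff.continuous_gradient {f : 𝔼 → ℝ} (hf : ContDiff ℝ ∞ f) :
    Continuous (gradient f) :=
  (InnerProductSpace.toDual ℝ 𝔼).symm.continuous.comp (hf.continuous_fderiv (by simp))

theorem gradient_eq_zero_of_notMem_tsupport {f : 𝔼 → ℝ} {x : 𝔼} (hx : x ∉ tsupport f) :
    gradient f x = 0 := by
  have : fderiv ℝ f x = 0 :=
    image_eq_zero_of_notMem_tsupport fun h => hx (tsupport_fderiv_subset ℝ h)
  simp [gradient, this]

theorem _root_.HasCompactSupport.gradient {f : 𝔼 → ℝ} (hf : HasCompactSupport f) :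
    HasCompactSupport (gradient f) :=
  HasCompactSupport.intro' hf (isClosed_tsupport f) fun _ hx =>
    gradient_eq_zero_of_notMem_tsupport hx

/-- Mollification commutes with weak differentiation away from the boundary. -/
theorem gradient_normed_convolution {U : Set 𝔼} {f : 𝔼 → ℝ} {g : 𝔼 → 𝔼}
    (hfm : Measurable f) (hgm : Measurable g) {C D : ℝ} (hC : ∀ x, ‖f x‖ ≤ C)
    (hD : ∀ x, ‖g x‖ ≤ D) (hf0 : ∀ x, x ∉ U → f x = 0) (hg0 : ∀ x, x ∉ U → g x = 0)
    (hw : HasWeakGradient U f g) (ρ : ContDiffBump (0 : 𝔼)) {x : 𝔼}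
    (hx : Metric.closedBall x ρ.rOut ⊆ U) :
    gradient ((ρ.normed volume) ⋆[ContinuousLinearMap.lsmul ℝ ℝ, volume] f) x =
      ((ρ.normed volume) ⋆[ContinuousLinearMap.lsmul ℝ ℝ, volume] g) x := by
  have hfl : LocallyIntegrable f := locallyIntegrable_of_bounded hfm.aestronglyMeasurable hC
  have hgl : LocallyIntegrable g := locallyIntegrable_of_bounded hgm.aestronglyMeasurable hD
  have hψ := isTest_comp_sub ρ hx
  set ψ : 𝔼 → ℝ := fun y => ρ.normed volume (x - y) with hψdef
  have hρ : ContDiff ℝ 1 (ρ.normed (volume : Measure 𝔼)) := ρ.contDiff_normed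
  have hfd := ρ.hasCompactSupport_normed.hasFDerivAt_convolution_right
    (ContinuousLinearMap.lsmul ℝ ℝ).flip hfl hρ x
  rw [convolution_flip] at hfd
  -- The sign from differentiating `ρ (x - y)` in `y` cancels the one in the definition of the weak
  -- gradient.
  have hgrad : ∀ y v, ⟪gradient ψ y, v⟫ = -fderiv ℝ (ρ.normed volume) (x - y) v := by
    intro y v
    rw [inner_gradient_left]
    have h1 : HasFDerivAt (ρ.normed (volume : Measure 𝔼))
        (fderiv ℝ (ρ.normed volume) (x - y)) (x - y) :=
      (hρ.differentiable one_ne_zero _).hasFDerivAt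
    have h2 : HasFDerivAt (fun y : 𝔼 => x - y) (-ContinuousLinearMap.id ℝ 𝔼) y :=
      (hasFDerivAt_id y).const_sub x
    have h3 := h1.comp y h2
    rw [show ψ = (ρ.normed volume) ∘ fun y => x - y from rfl, h3.fderiv]
    simp
  refine ext_inner_right ℝ fun v => ?_
  have hint : Integrable fun y => f y • gradient ψ y := by
    have h := hfl.integrable_smul_right_of_hasCompactSupport hψ.1.continuous_gradient
      hψ.2.1.gradient
    exact h
  have e1 : ∫ y, f y • gradient ψ y = -((ρ.normed volume) ⋆[ContinuousLinearMap.lsmul ℝ ℝ,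
      volume] g) x := by
    have h := hw ψ hψ
    rw [setIntegral_eq_integral_of_forall_compl_eq_zero (fun y hy => by simp [hf0 y hy]),
      setIntegral_eq_integral_of_forall_compl_eq_zero (fun y hy => by simp [hg0 y hy])] at h
    rw [h, convolution_eq_swap]
    rfl
  rw [inner_gradient_left, hfd.fderiv, convolution_precompR_apply _ hfl
    (ρ.hasCompactSupport_normed.fderiv ℝ) (hρ.continuous_fderiv one_ne_zero),
    ← neg_neg (((ρ.normed volume) ⋆[ContinuousLinearMap.lsmul ℝ ℝ, volume] g) x), ← e1,
    inner_neg_left, real_inner_comm, ← integral_inner hint, ← integral_neg]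
  refine integral_congr_ae (.of_forall fun y => ?_)
  have h := hgrad y v
  rw [inner_gradient_left] at h
  simp [inner_smul_right, h, mul_comm]

/-- Convergence at `y` passes to `x` when `u k x` and `u k y` stay close. The Cauchy estimate has
four terms of size `ε / 5`, which leaves strict inequality. -/
theorem exists_tendsto_of_forall_near {Y : Type*} {u : ℕ → Y → ℝ} {x : Y}
    (h : ∀ ε > 0, ∃ y, (∃ l, Tendsto (fun k => u k y) atTop (𝓝 l)) ∧
      ∀ᶠ k in atTop, |u k x - u k y| ≤ ε) :
    ∃ l, Tendsto (fun k => u k x) atTop (𝓝 l) := by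
  refine cauchySeq_tendsto_of_complete (Metric.cauchySeq_iff'.2 fun ε hε => ?_)
  obtain ⟨y, ⟨l, hl⟩, hy⟩ := h (ε / 5) (by positivity)
  have hl' := hl.eventually (Metric.ball_mem_nhds l (show 0 < ε / 5 by positivity))
  obtain ⟨N, hN⟩ := eventually_atTop.1 (hy.and hl')
  refine ⟨N, fun k hk => ?_⟩
  have h1 := hN k hk
  have h2 := hN N le_rfl
  rw [abs_le, Real.dist_eq, abs_lt] at h1 h2
  rw [Real.dist_eq, abs_lt]
  constructor <;> linarith [h1.1.1, h1.1.2, h2.1.1, h2.1.2, h1.2.1, h1.2.2, h2.2.1, h2.2.2]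

theorem eq_of_forall_near {Y : Type*} {u : ℕ → Y → ℝ} {x : Y} {l c : ℝ}
    (hl : Tendsto (fun k => u k x) atTop (𝓝 l))
    (h : ∀ ε > 0, ∃ y l', Tendsto (fun k => u k y) atTop (𝓝 l') ∧ |l' - c| ≤ ε ∧
      ∀ᶠ k in atTop, |u k x - u k y| ≤ ε) : l = c := by
  refine eq_of_abs_sub_le_all fun ε hε => ?_
  obtain ⟨y, l', hl', hc, hev⟩ := h (ε / 2) (by positivity)
  have h1 : |l - l'| ≤ ε / 2 := le_of_tendsto (hl.sub hl').abs hev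
  have h2 := abs_sub_le l l' c
  linarith

theorem exists_mem_ball_of_ae {U : Set 𝔼} {x : 𝔼} {r : ℝ} (hr : 0 < r)
    (hxU : Metric.ball x r ⊆ U) {p : 𝔼 → Prop} (hp : ∀ᵐ y ∂(volume.restrict U), p y) :
    ∃ y ∈ Metric.ball x r, p y := by
  have h1 : ∀ᵐ y ∂(volume.restrict (Metric.ball x r)), p y := ae_restrict_of_ae_restrict_of_subset
    hxU hp
  have : (volume.restrict (Metric.ball x r)) ≠ 0 := by
    rw [Ne, Measure.restrict_eq_zero]
    exact (Metric.measure_ball_pos volume x hr).ne'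
  have : (ae (volume.restrict (Metric.ball x r))).NeBot := ae_neBot.2 this
  obtain ⟨y, hy⟩ := (h1.and (ae_restrict_mem Metric.isOpen_ball.measurableSet)).exists
  exact ⟨y, hy.2, hy.1⟩

/-- A bounded function with bounded weak gradient is approximated by smooth functions that
converge everywhere on `U`. -/
theorem exists_smooth_approximation {U : Set 𝔼} (hU : IsOpen U) {φ : 𝔼 → ℝ} {G : 𝔼 → 𝔼}
    (hφ : MemLp φ ⊤ (volume.restrict U)) (hG : MemLp G ⊤ (volume.restrict U))
    (hw : HasWeakGradient U φ G) :
    ∃ (u : ℕ → 𝔼 → ℝ) (C : ℝ) (v : 𝔼 → ℝ), (∀ k, ContDiff ℝ ∞ (u k)) ∧ (∀ k x, |u k x| ≤ C) ∧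
      (∀ K ⊆ U, IsCompact K → ∀ᶠ k in atTop, ∀ x ∈ K, ‖gradient (u k) x‖ ≤ C) ∧
      (∀ᵐ x ∂(volume.restrict U), Tendsto (fun k => u k x) atTop (𝓝 (φ x))) ∧
      (∀ᵐ x ∂(volume.restrict U), Tendsto (fun k => gradient (u k) x) atTop (𝓝 (G x))) ∧
      Measurable v ∧ (∀ x, |v x| ≤ C) ∧ (∀ x ∈ U, Tendsto (fun k => u k x) atTop (𝓝 (v x))) ∧
      ∀ x ∈ U, ContinuousAt φ x → v x = φ x := by
  obtain ⟨f, Cf, hfm, hfC, hf0, hφf⟩ := exists_bounded_measurable hU.measurableSet hφ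
  obtain ⟨g, Cg, hgm, hgC, hg0, hGg⟩ := exists_bounded_measurable hU.measurableSet hG
  have hfw : HasWeakGradient U f g := by
    intro ψ hψ
    rw [integral_congr_ae (g := fun x => φ x • gradient ψ x)
        (by filter_upwards [hφf] with x hx; rw [hx]), hw ψ hψ,
      integral_congr_ae (by filter_upwards [hGg] with x hx; rw [hx])]
  have hfl : LocallyIntegrable f := locallyIntegrable_of_bounded hfm.aestronglyMeasurable hfC
  have hgl : LocallyIntegrable g := locallyIntegrable_of_bounded hgm.aestronglyMeasurable hgC
  let ρ : ℕ → ContDiffBump (0 : 𝔼) := fun k =>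
    ⟨1 / ((k : ℝ) + 1) / 2, 1 / ((k : ℝ) + 1), by positivity, half_lt_self (by positivity)⟩
  have hρ : Tendsto (fun k => (ρ k).rOut) atTop (𝓝 0) :=
    tendsto_one_div_add_atTop_nhds_zero_nat
  -- A bounded ratio of the radii is what Lebesgue differentiation needs for convergence almost
  -- everywhere.
  have hρ2 : ∀ᶠ k in atTop, (ρ k).rOut ≤ 2 * (ρ k).rIn := .of_forall fun k => by
    change 1 / ((k : ℝ) + 1) ≤ 2 * (1 / ((k : ℝ) + 1) / 2)
    linarith
  set u : ℕ → 𝔼 → ℝ := fun k =>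
    ((ρ k).normed volume) ⋆[ContinuousLinearMap.lsmul ℝ ℝ, volume] f with hu
  have hsm : ∀ k, ContDiff ℝ ∞ (u k) := fun k => contDiff_normed_convolution (ρ k) hfl
  have hgrad : ∀ K ⊆ U, IsCompact K → ∀ᶠ k in atTop, ∀ x ∈ K, gradient (u k) x =
      (((ρ k).normed volume) ⋆[ContinuousLinearMap.lsmul ℝ ℝ, volume] g) x := by
    intro K hKU hK
    obtain ⟨δ, hδ, hKδ⟩ := hK.exists_cthickening_subset_open hU hKU
    filter_upwards [hρ.eventually (gt_mem_nhds hδ)] with k hk x hx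
    refine gradient_normed_convolution hfm hgm hfC hgC hf0 hg0 hfw (ρ k) ?_
    exact (Metric.closedBall_subset_closedBall hk.le).trans
      ((Metric.closedBall_subset_cthickening hx δ).trans hKδ)
  have hgb : ∀ K ⊆ U, IsCompact K → ∀ᶠ k in atTop, ∀ x ∈ K, ‖gradient (u k) x‖ ≤ Cg := by
    intro K hKU hK
    filter_upwards [hgrad K hKU hK] with k hk x hx
    rw [hk x hx]
    exact norm_normed_convolution_le (ρ k) hgC x
  have hlimφ : ∀ᵐ x ∂(volume.restrict U), Tendsto (fun k => u k x) atTop (𝓝 (φ x)) := by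
    filter_upwards [hφf, ae_restrict_of_ae
      (ContDiffBump.ae_convolution_tendsto_right_of_locallyIntegrable hρ hρ2 hfl)] with x h1 h2
    rwa [h1]
  have hlimG : ∀ᵐ x ∂(volume.restrict U),
      Tendsto (fun k => gradient (u k) x) atTop (𝓝 (G x)) := by
    filter_upwards [hGg, ae_restrict_mem hU.measurableSet, ae_restrict_of_ae
      (ContDiffBump.ae_convolution_tendsto_right_of_locallyIntegrable hρ hρ2 hgl)] with x h1 h2 h3
    rw [h1]
    refine h3.congr' ?_
    filter_upwards [hgrad {x} (singleton_subset_iff.2 h2) isCompact_singleton] with k hk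
    exact (hk x rfl).symm
  -- On a small ball the mollifications eventually share the Lipschitz constant `Cg`. This upgrades
  -- convergence almost everywhere to convergence everywhere on `U`.
  have hnear : ∀ x ∈ U, ∀ ε > 0, ∃ r > 0, Metric.ball x r ⊆ U ∧ ∀ y ∈ Metric.ball x r,
      ∀ᶠ k in atTop, |u k x - u k y| ≤ ε := by
    intro x hx ε hε
    obtain ⟨R, hR, hRU⟩ := Metric.nhds_basis_closedBall.mem_iff.1 (hU.mem_nhds hx)
    have hCg : 0 ≤ Cg := (norm_nonneg _).trans (hgC 0)
    refine ⟨min R (ε / (Cg + 1)), by positivity, ?_, ?_⟩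
    · exact (Metric.ball_subset_closedBall.trans
        (Metric.closedBall_subset_closedBall (min_le_left _ _))).trans hRU
    · intro y hy
      filter_upwards [hgb _ hRU (isCompact_closedBall x R)] with k hk
      have h1 := (convex_closedBall x R).norm_image_sub_le_of_norm_fderiv_le (𝕜 := ℝ) (f := u k)
        (fun z _ => ((hsm k).differentiable (by simp)).differentiableAt)
        (fun z hz => (norm_gradient (u k) z).symm.trans_le (hk z hz))
        (x := y) (y := x)
        (Metric.ball_subset_closedBall (Metric.ball_subset_ball (min_le_left _ _) hy))
        (Metric.mem_closedBall_self hR.le)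
      rw [Metric.mem_ball, lt_min_iff, lt_div_iff₀ (by positivity), dist_comm, dist_eq_norm] at hy
      rw [Real.norm_eq_abs] at h1
      nlinarith [norm_nonneg (x - y), hy.2]
  have hconv : ∀ x ∈ U, ∃ l, Tendsto (fun k => u k x) atTop (𝓝 l) := by
    intro x hx
    refine exists_tendsto_of_forall_near fun ε hε => ?_
    obtain ⟨r, hr, hrU, h⟩ := hnear x hx ε hε
    obtain ⟨y, hy, hyl⟩ := exists_mem_ball_of_ae hr hrU hlimφ
    exact ⟨y, ⟨_, hyl⟩, h y hy⟩
  have hub : ∀ k x, |u k x| ≤ Cf := fun k x => norm_normed_convolution_le (ρ k) hfC x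
  choose! w hw' using hconv
  refine ⟨u, max Cf Cg, U.indicator w, hsm, fun k x => (hub k x).trans (le_max_left _ _), ?_,
    hlimφ, hlimG, ?_, ?_, ?_, ?_⟩
  · intro K hKU hK
    filter_upwards [hgb K hKU hK] with k hk x hx using (hk x hx).trans (le_max_right _ _)
  · refine measurable_of_tendsto_metrizable (f := fun k => U.indicator (u k))
      (fun k => (hsm k).continuous.measurable.indicator hU.measurableSet) ?_
    rw [tendsto_pi_nhds]
    intro x
    by_cases hx : x ∈ U
    · simpa [hx] using hw' x hx
    · simp [hx]
  · intro x
    by_cases hx : x ∈ U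
    · rw [indicator_of_mem hx]
      exact le_max_of_le_left (le_of_tendsto (hw' x hx).abs (.of_forall fun k => hub k x))
    · rw [indicator_of_notMem hx, abs_zero]
      exact le_max_of_le_left ((norm_nonneg _).trans (hfC 0))
  · intro x hx
    rw [indicator_of_mem hx]
    exact hw' x hx
  · intro x hx hc
    rw [indicator_of_mem hx]
    refine eq_of_forall_near (hw' x hx) fun ε hε => ?_
    obtain ⟨r, hr, hrU, h⟩ := hnear x hx ε hε
    obtain ⟨s, hs, hsc⟩ := Metric.continuousAt_iff.1 hc ε hε
    obtain ⟨y, hy, hyl⟩ := exists_mem_ball_of_ae (lt_min hr hs)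
      ((Metric.ball_subset_ball (min_le_left _ _)).trans hrU) hlimφ
    exact ⟨y, _, hyl, (hsc (Metric.ball_subset_ball (min_le_right _ _) hy)).le,
      h y (Metric.ball_subset_ball (min_le_left _ _) hy)⟩

end Mollification

/-! ### The product rule and the Gauss–Green formula for cutoff functions -/

section Divergence

variable {n : ℕ}

local notation "𝔼" => EuclideanSpace ℝ (Fin n)

theorem IsTest.exists_bound {U : Set 𝔼} {ψ : 𝔼 → ℝ} (hψ : IsTest U ψ) :
    ∃ B, ∀ x, |ψ x| ≤ B ∧ ‖gradient ψ x‖ ≤ B := by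
  obtain ⟨B₁, h₁⟩ := hψ.2.1.exists_bound_of_continuous hψ.1.continuous
  obtain ⟨B₂, h₂⟩ := hψ.2.1.gradient.exists_bound_of_continuous hψ.1.continuous_gradient
  exact ⟨max B₁ B₂, fun x => ⟨(h₁ x).trans (le_max_left _ _), (h₂ x).trans (le_max_right _ _)⟩⟩

theorem integrable_inner_of_bounded {X : Type*} [MeasurableSpace X] {m : Measure X} {F H : X → 𝔼}
    (hF : Integrable F m) (hH : AEStronglyMeasurable H m) {C : ℝ} (hC : ∀ᵐ x ∂m, ‖H x‖ ≤ C) :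
    Integrable (fun x => ⟪F x, H x⟫) m := by
  refine (hF.norm.mul_const C).mono' (hF.1.inner hH) ?_
  filter_upwards [hC] with x hx
  exact (norm_inner_le_norm _ _).trans (mul_le_mul_of_nonneg_left hx (norm_nonneg _))

theorem _root_.MeasureTheory.MemLp.exists_ae_norm_le {X V : Type*} [MeasurableSpace X]
    {m : Measure X} [NormedAddCommGroup V] {φ : X → V} (hφ : MemLp φ ⊤ m) :
    ∃ C, 0 ≤ C ∧ ∀ᵐ x ∂m, ‖φ x‖ ≤ C := by
  refine ⟨(eLpNorm φ ⊤ m).toReal, ENNReal.toReal_nonneg, ?_⟩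
  filter_upwards [enorm_ae_le_eLpNormEssSup φ m] with x hx
  rw [← eLpNorm_exponent_top] at hx
  simpa only [toReal_enorm] using ENNReal.toReal_mono hφ.2.ne hx

theorem gradient_mul {f g : 𝔼 → ℝ} {x : 𝔼} (hf : DifferentiableAt ℝ f x)
    (hg : DifferentiableAt ℝ g x) :
    gradient (fun y => f y * g y) x = f x • gradient g x + g x • gradient f x := by
  simp only [gradient]
  rw [fderiv_fun_mul hf hg, map_add, map_smul, map_smul]

/-- The product rule for the divergence, tested against smooth functions. -/
theorem IsDivergence.product_rule {U : Set 𝔼} (hU : IsOpen U) {F : 𝔼 → 𝔼}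
    (hF : MemLp F 1 (volume.restrict U)) {μ : SignedMeasure 𝔼} (hμ : IsDivergence U F μ)
    {φ : 𝔼 → ℝ} {G : 𝔼 → 𝔼} (hφ : MemLp φ ⊤ (volume.restrict U))
    (hG : MemLp G ⊤ (volume.restrict U)) (hw : HasWeakGradient U φ G) :
    ∃ (v : 𝔼 → ℝ) (C : ℝ), Measurable v ∧ (∀ x, |v x| ≤ C) ∧
      (∀ x ∈ U, ContinuousAt φ x → v x = φ x) ∧ ∀ ψ, IsTest U ψ →
        ∫ x in U, (⟪φ x • F x, gradient ψ x⟫ + ψ x * ⟪F x, G x⟫) = -∫ᵛ x, ψ x * v x ∂•μ := by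
  obtain ⟨u, C, v, hsm, huC, hgu, hlim, hlimG, hvm, hvC, huv, hvφ⟩ :=
    exists_smooth_approximation hU hφ hG hw
  refine ⟨v, C, hvm, hvC, hvφ, fun ψ hψ => ?_⟩
  have := isFiniteMeasure_variation μ
  obtain ⟨B, hB⟩ := hψ.exists_bound
  have hB0 : 0 ≤ B := (abs_nonneg _).trans (hB 0).1
  have hC0 : 0 ≤ C := (abs_nonneg _).trans (hvC 0)
  have hFi : Integrable F (volume.restrict U) := memLp_one_iff_integrable.1 hF
  have htest : ∀ k, IsTest U fun x => ψ x * u k x := fun k =>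
    ⟨hψ.1.mul (hsm k), hψ.2.1.mul_right, (tsupport_mul_subset_left).trans hψ.2.2⟩
  have hgr : ∀ k x, gradient (fun x => ψ x * u k x) x =
      ψ x • gradient (u k) x + u k x • gradient ψ x := fun k x =>
    gradient_mul ((hψ.1.differentiable (by simp)).differentiableAt)
      (((hsm k).differentiable (by simp)).differentiableAt)
  have hl : Tendsto (fun k => ∫ x in U, ⟪F x, gradient (fun x => ψ x * u k x) x⟫) atTop
      (𝓝 (∫ x in U, (⟪φ x • F x, gradient ψ x⟫ + ψ x * ⟪F x, G x⟫))) := by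
    refine tendsto_integral_filter_of_dominated_convergence
      (fun x => ‖F x‖ * (B * C + C * B)) ?_ ?_ (hFi.norm.mul_const _) ?_
    · exact .of_forall fun k => hFi.1.inner
        ((htest k).1.continuous_gradient.aestronglyMeasurable)
    · filter_upwards [hgu _ hψ.2.2 hψ.2.1] with k hk
      -- The gradients of `u k` are controlled only on the compact support of `ψ`; elsewhere the
      -- factor `ψ` removes them.
      refine .of_forall fun x => (norm_inner_le_norm _ _).trans ?_
      refine mul_le_mul_of_nonneg_left ?_ (norm_nonneg _)
      rw [hgr]
      refine (norm_add_le _ _).trans (add_le_add ?_ ?_)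
      · rw [norm_smul]
        by_cases hx : x ∈ tsupport ψ
        · exact mul_le_mul (hB x).1 (hk x hx) (norm_nonneg _) hB0
        · rw [image_eq_zero_of_notMem_tsupport hx, norm_zero, zero_mul]
          positivity
      · rw [norm_smul]
        exact mul_le_mul (huC k x) (hB x).2 (norm_nonneg _) hC0
    · filter_upwards [hlim, hlimG] with x h1 h2
      have h3 : Tendsto (fun k => u k x * ⟪F x, gradient ψ x⟫ + ψ x * ⟪F x, gradient (u k) x⟫) atTop
          (𝓝 (φ x * ⟪F x, gradient ψ x⟫ + ψ x * ⟪F x, G x⟫)) :=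
        (h1.mul_const _).add ((tendsto_const_nhds.inner h2).const_mul _)
      rw [real_inner_smul_left]
      refine h3.congr fun k => ?_
      rw [hgr, inner_add_right, real_inner_smul_right, real_inner_smul_right, add_comm]
  -- Here convergence at every point of `U` is essential: `μ` may charge Lebesgue null sets.
  have hr : Tendsto (fun k => -∫ᵛ x, ψ x * u k x ∂•μ) atTop (𝓝 (-∫ᵛ x, ψ x * v x ∂•μ)) := by
    refine (VectorMeasure.tendsto_integral_filter_of_norm_le_const
      (.of_forall fun k => (htest k).1.continuous.aestronglyMeasurable)
      ⟨B * C, .of_forall fun k => .of_forall fun x => ?_⟩ ?_).neg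
    · rw [norm_mul]
      exact mul_le_mul (hB x).1 (huC k x) (norm_nonneg _) hB0
    · have h0 : ∀ᵐ x ∂μ.variation, x ∈ U := by
        rw [ae_iff]; exact hμ.1
      filter_upwards [h0] with x hx using (huv x hx).const_mul _
  refine tendsto_nhds_unique hl (hr.congr fun k => ?_)
  exact (hμ.2 _ (htest k)).symm

theorem integrable_of_bounded_signedMeasure (σ : SignedMeasure 𝔼) {f : 𝔼 → ℝ}
    (hf : AEStronglyMeasurable f σ.variation) {C : ℝ} (hC : ∀ x, |f x| ≤ C) : σ.Integrable f :=
  have := isFiniteMeasure_variation σ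
  (integrable_const C).mono' hf (.of_forall hC)

/-- If `F` is an integrable field whose divergence is a measure `μ` and `φ ∈ W^{1,∞}(U)`,
then the divergence of `φ F` is a measure, absolutely continuous with respect to
`|μ| + 𝓛ⁿ`. -/
theorem IsDivergence.exists_smul {U : Set 𝔼} (hU : IsOpen U) {F : 𝔼 → 𝔼}
    (hF : MemLp F 1 (volume.restrict U)) {μ : SignedMeasure 𝔼} (hμ : IsDivergence U F μ)
    {φ : 𝔼 → ℝ} (hφ : MemW1Inf U φ) :
    ∃ μ', IsDivergence U (fun x => φ x • F x) μ' ∧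
      ∀ N, μ.variation N = 0 → (volume.restrict U) N = 0 → μ'.variation N = 0 := by
  obtain ⟨hφ, G, hG, hw⟩ := hφ
  obtain ⟨v, C, hvm, hvC, -, hv⟩ := hμ.product_rule hU hF hφ hG hw
  have := isFiniteMeasure_variation μ
  obtain ⟨h, hh, hμh⟩ := exists_eq_variation_withDensityᵥ μ
  obtain ⟨D, hD0, hD⟩ := hG.exists_ae_norm_le
  obtain ⟨D', hD'0, hD'⟩ := hφ.exists_ae_norm_le
  have hFi : Integrable F (volume.restrict U) := memLp_one_iff_integrable.1 hF
  have hφF : Integrable (fun x => φ x • F x) (volume.restrict U) := hFi.bdd_smul D' hφ.1 hD'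
  have hFG := integrable_inner_of_bounded hFi hG.1 hD
  have hvh : Integrable (fun x => v x * h x) μ.variation :=
    hh.bdd_mul hvm.aestronglyMeasurable (.of_forall hvC)
  -- With `μ = h |μ|`, the divergence of `φ F` is the sum of `a = v μ` and `b = (F · G) 𝓛ⁿ`.
  set a := μ.variation.withDensityᵥ fun x => v x * h x with ha
  set b := (volume.restrict U).withDensityᵥ fun x => ⟪F x, G x⟫ with hb
  have hN : ∀ N, μ.variation N = 0 → (volume.restrict U) N = 0 → (a + b).variation N = 0 := by
    intro N h1 h2
    refine le_antisymm ((VectorMeasure.variation_add_le N).trans ?_) zero_le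
    rw [Measure.add_apply, ha, hb, Measure.variation_withDensityᵥ hvh,
      Measure.variation_withDensityᵥ hFG, withDensity_absolutelyContinuous _ _ h1,
      withDensity_absolutelyContinuous _ _ h2, add_zero]
  refine ⟨a + b, ⟨hN _ hμ.1 ?_, fun ψ hψ => ?_⟩, hN⟩
  · rw [Measure.restrict_apply hU.measurableSet.compl]; simp
  obtain ⟨B, hB⟩ := hψ.exists_bound
  have hψm : Measurable ψ := hψ.1.continuous.measurable
  have e1 := hv ψ hψ
  rw [integral_add (integrable_inner_of_bounded hφF
    hψ.1.continuous_gradient.aestronglyMeasurable (.of_forall fun x => (hB x).2))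
    (hFG.bdd_mul hψm.aestronglyMeasurable (.of_forall fun x => (hB x).1))] at e1
  rw [VectorMeasure.integral_add_vectorMeasure
    (integrable_of_bounded_signedMeasure _ hψm.aestronglyMeasurable fun x => (hB x).1)
    (integrable_of_bounded_signedMeasure _ hψm.aestronglyMeasurable fun x => (hB x).1),
    integral_withDensityᵥ_smul hvh hψm.aestronglyMeasurable fun x => (hB x).1,
    integral_withDensityᵥ_smul hFG hψm.aestronglyMeasurable fun x => (hB x).1]
  have e2 : ∫ᵛ x, ψ x * v x ∂•μ = ∫ x, ψ x * (v x * h x) ∂μ.variation := by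
    conv_lhs => rw [← hμh]
    rw [integral_withDensityᵥ_smul (f := fun x => ψ x * v x) hh
      (hψm.mul hvm).aestronglyMeasurable (C := B * C)]
    · simp only [mul_assoc]
    · intro x
      rw [abs_mul]
      exact mul_le_mul (hB x).1 (hvC x) (abs_nonneg _) ((abs_nonneg _).trans (hB x).1)
  rw [← e2]
  linarith

theorem IsTest.mono {U V : Set 𝔼} {ψ : 𝔼 → ℝ} (hψ : IsTest U ψ) (hUV : U ⊆ V) : IsTest V ψ :=
  ⟨hψ.1, hψ.2.1, hψ.2.2.trans hUV⟩

/-- Having `η = 1` on a neighbourhood of each point of `K`, not only on `K`, makes the gradient of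
`η` vanish there. -/
theorem exists_cutoff {K V : Set 𝔼} (hK : IsCompact K) (hV : IsOpen V) (hKV : K ⊆ V) :
    ∃ η, IsTest V η ∧ (∀ x ∈ K, η =ᶠ[𝓝 x] fun _ => 1) ∧ ∀ x, η x ∈ Icc (0 : ℝ) 1 := by
  obtain ⟨δ, hδ, hKδ⟩ := hK.exists_cthickening_subset_open hV hKV
  obtain ⟨η, h1, h0, h01⟩ := exists_contMDiffMap_one_nhds_of_subset_interior (n := ⊤)
    (modelWithCornersSelf ℝ 𝔼) hK.isClosed ((Metric.self_subset_thickening hδ K).trans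
      (interior_maximal (Metric.thickening_subset_cthickening δ K) Metric.isOpen_thickening))
  have hs : tsupport η ⊆ Metric.cthickening δ K :=
    closure_minimal (fun x hx => by_contra fun h => hx (h0 x h)) Metric.isClosed_cthickening
  exact ⟨η, ⟨η.contMDiff.contDiff, HasCompactSupport.intro' hK.cthickening
    Metric.isClosed_cthickening h0, hs.trans hKδ⟩,
    fun x hx => (mem_nhdsSet_iff_forall.1 h1) x hx, h01⟩

/-- A signed measure vanishes on a compact set `K` if it nearly annihilates cutoff functions
of `K` with arbitrarily small supports around `K`. -/
theorem apply_eq_zero_of_cutoffs (σ : SignedMeasure 𝔼) {K : Set 𝔼} (hK : IsCompact K)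
    (h : ∀ ε > 0, ∃ ψ : 𝔼 → ℝ, Continuous ψ ∧ (∀ x, ψ x ∈ Icc (0 : ℝ) 1) ∧ (∀ x ∈ K, ψ x = 1) ∧
      (∀ x ∉ Metric.thickening ε K, ψ x = 0) ∧ |∫ᵛ x, ψ x ∂•σ| ≤ ε) : σ K = 0 := by
  have := isFiniteMeasure_variation σ
  choose ψ hc h01 h1 h0 hε using fun k : ℕ => h (1 / ((k : ℝ) + 1)) (by positivity)
  have hε0 := tendsto_one_div_add_atTop_nhds_zero_nat (𝕜 := ℝ)
  -- As `K` is closed, the shrinking supports make the cutoffs converge pointwise to its indicator.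
  have hlim : Tendsto (fun k => ∫ᵛ x, ψ k x ∂•σ) atTop
      (𝓝 (∫ᵛ x, K.indicator (fun _ => 1) x ∂•σ)) := by
    refine VectorMeasure.tendsto_integral_filter_of_norm_le_const
      (.of_forall fun k => (hc k).aestronglyMeasurable)
      ⟨1, .of_forall fun k => .of_forall fun x => ?_⟩ (.of_forall fun x => ?_)
    · rw [Real.norm_of_nonneg (h01 k x).1]
      exact (h01 k x).2
    · by_cases hx : x ∈ K
      · simp [hx, h1]
      · rw [indicator_of_notMem hx]
        obtain ⟨r, hr, hrK⟩ := Metric.isOpen_iff.1 hK.isClosed.isOpen_compl x hx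
        refine tendsto_const_nhds.congr' ?_
        filter_upwards [hε0.eventually (gt_mem_nhds hr)] with k hk
        refine (h0 k x fun hxt => ?_).symm
        obtain ⟨z, hz, hxz⟩ := Metric.mem_thickening_iff.1 hxt
        exact hrK (by rw [Metric.mem_ball, dist_comm]; exact hxz.trans hk) hz
  have h2 : Tendsto (fun k => ∫ᵛ x, ψ k x ∂•σ) atTop (𝓝 0) :=
    squeeze_zero_norm hε hε0
  have h3 := tendsto_nhds_unique hlim h2
  rw [VectorMeasure.integral_indicator hK.measurableSet, VectorMeasure.integral_const,
    VectorMeasure.restrict_apply _ hK.measurableSet .univ, univ_inter] at h3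
  simpa using h3

/-- The difference annihilates test functions, so it vanishes on compact subsets of `U`; off `U`
both measures vanish by definition. -/
theorem IsDivergence.unique {U : Set 𝔼} (hU : IsOpen U) {F : 𝔼 → 𝔼} {μ μ' : SignedMeasure 𝔼}
    (hμ : IsDivergence U F μ) (hμ' : IsDivergence U F μ') : μ = μ' := by
  rw [← sub_eq_zero, ← VectorMeasure.variation_eq_zero, ← Measure.measure_univ_eq_zero,
    ← union_compl_self U, ← nonpos_iff_eq_zero]
  refine (measure_union_le _ _).trans ?_
  have h1 : (μ - μ').variation Uᶜ = 0 := by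
    refine le_antisymm ((VectorMeasure.variation_sub_le Uᶜ).trans ?_) zero_le
    rw [Measure.add_apply, hμ.1, hμ'.1, add_zero]
  have h2 : (μ - μ').variation U = 0 := by
    refine variation_eq_zero_of_isCompact _ hU.measurableSet fun K hKU hK => ?_
    refine apply_eq_zero_of_cutoffs _ hK fun ε hε => ?_
    obtain ⟨η, hη, hη1, h01⟩ := exists_cutoff hK (hU.inter (Metric.isOpen_thickening (δ := ε)))
      (subset_inter hKU (Metric.self_subset_thickening hε K))
    refine ⟨η, hη.1.continuous, h01, fun x hx => (hη1 x hx).self_of_nhds, fun x hx => ?_, ?_⟩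
    · exact image_eq_zero_of_notMem_tsupport fun h => hx (hη.2.2 h).2
    · have hb : ∀ x, |η x| ≤ 1 := fun x => by rw [abs_of_nonneg (h01 x).1]; exact (h01 x).2
      have hηU := hη.mono inter_subset_left
      rw [VectorMeasure.integral_sub_vectorMeasure
        (integrable_of_bounded_signedMeasure _ hη.1.continuous.aestronglyMeasurable hb)
        (integrable_of_bounded_signedMeasure _ hη.1.continuous.aestronglyMeasurable hb),
        neg_injective ((hμ.2 η hηU).symm.trans (hμ'.2 η hηU)), sub_self, abs_zero]
      exact hε.le
  rw [h1, h2, add_zero]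

theorem MemDM.isDivergence {U : Set 𝔼} {p : ℝ≥0∞} {F : 𝔼 → 𝔼} (hF : MemDM U p F) :
    IsDivergence U F (divMeasure U F) := by
  rw [divMeasure, dif_pos hF.2]
  exact hF.2.choose_spec

theorem MemW1Inf.weakGradient_spec {U : Set 𝔼} {f : 𝔼 → ℝ} (hf : MemW1Inf U f) :
    MemLp (weakGradient U f) ⊤ (volume.restrict U) ∧ HasWeakGradient U f (weakGradient U f) := by
  rw [weakGradient, dif_pos hf.2]
  exact hf.2.choose_spec

/-- Test functions supported in `U \ tsupport f` do not see `f`, so the fundamental lemma of the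
calculus of variations applies there. -/
theorem HasWeakGradient.ae_eq_zero {U : Set 𝔼} (hU : IsOpen U) {f : 𝔼 → ℝ} {G : 𝔼 → 𝔼}
    (hG : MemLp G ⊤ (volume.restrict U)) (hw : HasWeakGradient U f G) :
    ∀ᵐ x ∂(volume.restrict U), x ∉ tsupport f → G x = 0 := by
  have h := (hU.sdiff (isClosed_tsupport f)).ae_eq_zero_of_integral_contDiff_smul_eq_zero
    (μ := volume.restrict U) ((hG.locallyIntegrable le_top).locallyIntegrableOn _)
    (fun g hg hgc hgs => ?_)
  · filter_upwards [h, ae_restrict_mem hU.measurableSet] with x h1 h2 h3 using h1 ⟨h2, h3⟩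
  · rw [← neg_eq_zero, ← hw g ⟨hg, hgc, hgs.trans sdiff_subset⟩]
    refine integral_eq_zero_of_ae (.of_forall fun x => ?_)
    by_cases hx : x ∈ tsupport f
    · have : x ∉ tsupport g := fun h => (hgs h).2 hx
      simp [gradient_eq_zero_of_notMem_tsupport this]
    · simp [image_eq_zero_of_notMem_tsupport hx]

/-- The Gauss–Green formula for compactly supported continuous functions in `W^{1,∞}(U)`. -/
theorem IsDivergence.integral_inner_weakGradient {U : Set 𝔼} (hU : IsOpen U) {F : 𝔼 → 𝔼}
    (hF : MemLp F 1 (volume.restrict U)) {μ : SignedMeasure 𝔼} (hμ : IsDivergence U F μ)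
    {f : 𝔼 → ℝ} (hf : MemW1Inf U f) (hfc : Continuous f) (hfs : HasCompactSupport f)
    (hfU : tsupport f ⊆ U) :
    ∫ x in U, ⟪F x, weakGradient U f x⟫ = -∫ᵛ x, f x ∂•μ := by
  obtain ⟨hG, hw⟩ := hf.weakGradient_spec
  obtain ⟨v, C, -, -, hvf, hv⟩ := hμ.product_rule hU hF hf.1 hG hw
  -- As `η` is 1 near `tsupport f`, the term with its gradient vanishes and the factor `η` drops
  -- out; continuity of `f` identifies `v` with `f` on `U`.
  obtain ⟨η, hη, hη1, -⟩ := exists_cutoff hfs hU hfU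
  have h := hv η hη
  have h0 : ∀ᵐ x ∂μ.variation, x ∈ U := by
    rw [ae_iff]; exact hμ.1
  rw [VectorMeasure.integral_congr_ae (g := f)] at h
  · rw [← h]
    refine integral_congr_ae ?_
    filter_upwards [hw.ae_eq_zero hU hG] with x hx
    by_cases hxs : x ∈ tsupport f
    · have h1 : gradient η x = 0 := by
        rw [gradient, (hη1 x hxs).fderiv_eq]; simp
      simp [h1, (hη1 x hxs).self_of_nhds]
    · simp [image_eq_zero_of_notMem_tsupport hxs, hx hxs]
  · filter_upwards [h0] with x hx
    rw [hvf x hx hfc.continuousAt]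
    by_cases hxs : x ∈ tsupport f
    · simp [(hη1 x hxs).self_of_nhds]
    · simp [image_eq_zero_of_notMem_tsupport hxs]

end Divergence

/-! ### Hausdorff null sets and bounded divergence measure fields -/

section Hausdorff

variable {n : ℕ}

local notation "𝔼" => EuclideanSpace ℝ (Fin n)

/-- Raising the dimension keeps null sets null, and Lebesgue measure is a multiple of `𝓗ⁿ` by
uniqueness of Haar measure. -/
theorem volume_eq_zero_of_hausdorffMeasure_eq_zero {A : Set 𝔼}
    (hA : (Measure.hausdorffMeasure ((n : ℝ) - 1) : Measure 𝔼) A = 0) :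
    (volume : Measure 𝔼) A = 0 := by
  have h1 : (Measure.hausdorffMeasure (n : ℝ) : Measure 𝔼) A = 0 :=
    le_antisymm ((Measure.hausdorffMeasure_mono (by linarith) A).trans hA.le) zero_le
  rw [Measure.isAddLeftInvariant_eq_smul (volume : Measure 𝔼) (Measure.hausdorffMeasure (n : ℝ)),
    Measure.smul_apply, h1, smul_zero]

/-- A compact Hausdorff null set is covered by finitely many small balls. -/
theorem exists_finite_cover_of_hausdorffMeasure_eq_zero {X : Type*} [MetricSpace X]
    [Nonempty X] [MeasurableSpace X] [BorelSpace X] {d : ℝ} (hd : 0 ≤ d) {K : Set X} (hK : IsCompact K)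
    (hK0 : Measure.hausdorffMeasure d K = 0) {ε : ℝ} (hε : 0 < ε) :
    ∃ (s : Finset ℕ) (c : ℕ → X) (r : ℕ → ℝ), (∀ i ∈ s, c i ∈ K ∧ 0 < r i ∧ r i ≤ ε) ∧
      K ⊆ ⋃ i ∈ s, Metric.ball (c i) (r i) ∧ ∑ i ∈ s, r i ^ d ≤ ε := by
  have hε2 : 0 < ε / 2 := half_pos hε
  obtain ⟨t, hKt, htd, hsum⟩ : ∃ t : ℕ → Set X, K ⊆ ⋃ i, t i ∧
      (∀ i, Metric.ediam (t i) ≤ ENNReal.ofReal (ε / 2)) ∧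
      ∑' i, ⨆ _ : (t i).Nonempty, Metric.ediam (t i) ^ d < ENNReal.ofReal (ε / 2) := by
    have h0 : ⨅ (t : ℕ → Set X) (_ : K ⊆ ⋃ i, t i)
        (_ : ∀ i, Metric.ediam (t i) ≤ ENNReal.ofReal (ε / 2)),
        ∑' i, ⨆ _ : (t i).Nonempty, Metric.ediam (t i) ^ d < ENNReal.ofReal (ε / 2) := by
      refine lt_of_le_of_lt ?_ (ENNReal.ofReal_pos.2 hε2)
      rw [← hK0, Measure.hausdorffMeasure_apply]
      exact le_iSup₂_of_le (ENNReal.ofReal (ε / 2)) (ENNReal.ofReal_pos.2 hε2) le_rfl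
    simp only [iInf_lt_iff] at h0
    obtain ⟨t, h1, h2, h3⟩ := h0
    exact ⟨t, h1, h2, h3⟩
  -- Half of `ε` is reserved for enlarging each radius strictly beyond the diameter of `t i`: an
  -- open ball about a point of `t i ∩ K` then contains `t i`, even if that is a single point.
  obtain ⟨δ, hδ, hδs⟩ : ∃ δ : ℕ → ℝ, (∀ i, 0 < δ i) ∧ ∀ s : Finset ℕ, ∑ i ∈ s, δ i ≤ ε / 2 := by
    obtain ⟨δ, hδ, c₀, hδs, hc₀⟩ := posSumOfEncodable hε2 ℕ
    exact ⟨δ, hδ, fun s => (sum_le_hasSum s (fun i _ => (hδ i).le) hδs).trans hc₀⟩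
  have hdiam : ∀ i, Metric.ediam (t i) = ENNReal.ofReal (Metric.diam (t i)) := fun i =>
    (ENNReal.ofReal_toReal (ne_top_of_le_ne_top ENNReal.ofReal_ne_top (htd i))).symm
  have hex : ∀ i, ∃ (c : X) (r : ℝ), (t i ∩ K).Nonempty → c ∈ t i ∧ c ∈ K ∧
      Metric.diam (t i) < r ∧ r ≤ ε ∧ r ^ d ≤ Metric.diam (t i) ^ d + δ i := by
    intro i
    by_cases hi : (t i ∩ K).Nonempty
    swap
    · exact ⟨Classical.arbitrary X, 0, fun h => absurd h hi⟩
    obtain ⟨c, hct, hcK⟩ := hi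
    have hDε : Metric.diam (t i) < ε := by
      have h1 := htd i
      rw [hdiam, ENNReal.ofReal_le_ofReal_iff hε2.le] at h1
      linarith
    have h1 : ∀ᶠ r in 𝓝[>] (Metric.diam (t i)), r ^ d < Metric.diam (t i) ^ d + δ i :=
      ((Real.continuousAt_rpow_const _ d (Or.inr hd)).eventually
        (gt_mem_nhds (lt_add_of_pos_right _ (hδ i)))).filter_mono nhdsWithin_le_nhds
    have h2 : ∀ᶠ r in 𝓝[>] (Metric.diam (t i)), r < ε :=
      (gt_mem_nhds hDε).filter_mono nhdsWithin_le_nhds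
    obtain ⟨r, hr1, hr2, hr3⟩ := (h1.and (h2.and self_mem_nhdsWithin)).exists
    exact ⟨c, r, fun _ => ⟨hct, hcK, hr3, hr2.le, hr1.le⟩⟩
  choose c r hcr using hex
  obtain ⟨b, hbI, hbf, hKb⟩ := hK.elim_finite_subcover_image (b := {i | (t i ∩ K).Nonempty})
    (c := fun i => Metric.ball (c i) (r i)) (fun _ _ => Metric.isOpen_ball) (by
      intro x hx
      obtain ⟨i, hi⟩ := mem_iUnion.1 (hKt hx)
      have hne : (t i ∩ K).Nonempty := ⟨x, hi, hx⟩
      obtain ⟨h1, -, h3, -⟩ := hcr i hne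
      refine mem_biUnion (x := i) hne (lt_of_le_of_lt ?_ h3)
      exact Metric.dist_le_diam_of_mem' (ne_top_of_le_ne_top ENNReal.ofReal_ne_top (htd i)) hi h1)
  have hsI : ∀ i ∈ hbf.toFinset, (t i ∩ K).Nonempty := fun i hi => hbI (hbf.mem_toFinset.1 hi)
  refine ⟨hbf.toFinset, c, r, fun i hi => ?_, ?_, ?_⟩
  · obtain ⟨-, h2, h3, h4, -⟩ := hcr i (hsI i hi)
    exact ⟨h2, Metric.diam_nonneg.trans_lt h3, h4⟩
  · simpa using hKb
  · have h1 : ∑ i ∈ hbf.toFinset, Metric.diam (t i) ^ d ≤ ε / 2 := by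
      rw [← ENNReal.ofReal_le_ofReal_iff hε2.le, ENNReal.ofReal_sum_of_nonneg
        fun i _ => Real.rpow_nonneg Metric.diam_nonneg d]
      refine le_trans ?_ hsum.le
      refine le_trans (Finset.sum_le_sum fun i hi => ?_) (ENNReal.sum_le_tsum hbf.toFinset)
      rw [ciSup_pos ((hsI i hi).mono inter_subset_left), hdiam,
        ENNReal.ofReal_rpow_of_nonneg Metric.diam_nonneg hd]
    calc ∑ i ∈ hbf.toFinset, r i ^ d ≤ ∑ i ∈ hbf.toFinset, (Metric.diam (t i) ^ d + δ i) :=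
          Finset.sum_le_sum fun i hi => (hcr i (hsI i hi)).2.2.2.2
      _ ≤ ε := by
          rw [Finset.sum_add_distrib]
          linarith [hδs hbf.toFinset]

/-- A family of cutoff functions of balls with controlled gradients. -/
theorem exists_bump_gradient_le : ∃ L : ℝ, 0 ≤ L ∧ ∀ (c : 𝔼) (r : ℝ), 0 < r → ∃ g : 𝔼 → ℝ,
    ContDiff ℝ ∞ g ∧ (∀ x, g x ∈ Icc (0 : ℝ) 1) ∧ (∀ x ∈ Metric.ball c r, g x = 1) ∧
      (∀ x ∉ Metric.ball c (2 * r), g x = 0) ∧ ∀ x, ‖fderiv ℝ g x‖ ≤ L / r := by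
  let b : ContDiffBump (0 : 𝔼) := ⟨1, 2, one_pos, one_lt_two⟩
  have hb : ContDiff ℝ ∞ b := b.contDiff
  obtain ⟨L, hL⟩ := (b.hasCompactSupport.fderiv ℝ).exists_bound_of_continuous
    (hb.continuous_fderiv (by simp))
  refine ⟨L, (norm_nonneg _).trans (hL 0), fun c r hr => ⟨fun x => b (r⁻¹ • (x - c)),
    hb.comp (by fun_prop),
    fun x => ⟨b.nonneg, b.le_one⟩, fun x hx => ?_, fun x hx => ?_, fun x => ?_⟩⟩
  · refine b.one_of_mem_closedBall ?_
    rw [Metric.mem_ball, dist_eq_norm] at hx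
    rw [mem_closedBall_zero_iff, norm_smul, norm_inv, Real.norm_of_nonneg hr.le,
      inv_mul_le_iff₀ hr]
    change _ ≤ r * 1
    linarith
  · refine b.zero_of_le_dist ?_
    rw [Metric.mem_ball, dist_eq_norm, not_lt] at hx
    rw [dist_zero_right, norm_smul, norm_inv, Real.norm_of_nonneg hr.le, le_inv_mul_iff₀ hr]
    change r * 2 ≤ _
    linarith
  · have h1 : HasFDerivAt (fun x : 𝔼 => r⁻¹ • (x - c)) (r⁻¹ • ContinuousLinearMap.id ℝ 𝔼) x :=
      ((hasFDerivAt_id x).sub_const c).const_smul r⁻¹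
    have h2 := ((hb.differentiable (by simp)) (r⁻¹ • (x - c))).hasFDerivAt.comp x h1
    have h3 : fderiv ℝ (fun x => b (r⁻¹ • (x - c))) x =
        r⁻¹ • fderiv ℝ b (r⁻¹ • (x - c)) := by
      rw [show (fun x => b (r⁻¹ • (x - c))) = b ∘ fun x => r⁻¹ • (x - c) from rfl, h2.fderiv]
      ext; simp
    rw [h3, norm_smul, norm_inv, Real.norm_of_nonneg hr.le, div_eq_inv_mul]
    exact mul_le_mul_of_nonneg_left (hL _) (inv_nonneg.2 hr.le)

/-- `1 - ∏ (1 - gᵢ)` serves as a smooth cutoff of a union. All factors lie in `[0, 1]`, so the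
product rule adds up the gradient bounds without further constants. -/
theorem prod_one_sub_properties {ι : Type*} (s : Finset ι) {g : ι → 𝔼 → ℝ}
    (hg : ∀ i ∈ s, ContDiff ℝ ∞ (g i)) (hg01 : ∀ i ∈ s, ∀ x, g i x ∈ Icc (0 : ℝ) 1) :
    ContDiff ℝ ∞ (fun x => ∏ i ∈ s, (1 - g i x)) ∧
      (∀ x, ∏ i ∈ s, (1 - g i x) ∈ Icc (0 : ℝ) 1) ∧
      ∀ x, ‖fderiv ℝ (fun x => ∏ i ∈ s, (1 - g i x)) x‖ ≤ ∑ i ∈ s, ‖fderiv ℝ (g i) x‖ := by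
  classical
  induction s using Finset.induction_on with
  | empty => simp [contDiff_const]
  | insert a s ha ih =>
    obtain ⟨h1, h2, h3⟩ := ih (fun i hi => hg i (Finset.mem_insert_of_mem hi))
      (fun i hi => hg01 i (Finset.mem_insert_of_mem hi))
    have ga := hg a (Finset.mem_insert_self a s)
    have ga01 := hg01 a (Finset.mem_insert_self a s)
    simp only [Finset.prod_insert ha, Finset.sum_insert ha]
    refine ⟨(contDiff_const.sub ga).mul h1, fun x => ?_, fun x => ?_⟩
    · exact ⟨mul_nonneg (by linarith [(ga01 x).2]) (h2 x).1,
        mul_le_one₀ (by linarith [(ga01 x).1]) (h2 x).1 (h2 x).2⟩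
    · have d1 : DifferentiableAt ℝ (g a) x := (ga.differentiable (by simp)) x
      have d2 : DifferentiableAt ℝ (fun x => ∏ i ∈ s, (1 - g i x)) x :=
        (h1.differentiable (by simp)) x
      rw [fderiv_fun_mul (d1.const_sub 1) d2, fderiv_const_sub]
      refine (norm_add_le _ _).trans ?_
      rw [norm_smul, norm_smul, norm_neg, add_comm, Real.norm_of_nonneg (h2 x).1,
        Real.norm_of_nonneg (by linarith [(ga01 x).2])]
      refine add_le_add ?_ ?_
      · exact mul_le_of_le_one_left (norm_nonneg _) (h2 x).2
      · exact (mul_le_of_le_one_left (norm_nonneg _) (by linarith [(ga01 x).1])).trans (h3 x)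

/-- The gradient is at most `L / r` and lives on a ball of volume proportional to `(2 r) ^ n`. -/
theorem integral_norm_gradient_bump_le {L : ℝ} {g : 𝔼 → ℝ} {c : 𝔼} {r : ℝ}
    (hr : 0 < r) (hg : ContDiff ℝ ∞ g) (h0 : ∀ x ∉ Metric.ball c (2 * r), g x = 0)
    (hL : ∀ x, ‖fderiv ℝ g x‖ ≤ L / r) :
    Integrable (fun x => ‖fderiv ℝ g x‖) ∧ ∫ x, ‖fderiv ℝ g x‖ ≤
      L * 2 ^ n * (volume : Measure 𝔼).real (Metric.closedBall 0 1) * r ^ ((n : ℝ) - 1) := by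
  have hcs : HasCompactSupport g := HasCompactSupport.intro' (isCompact_closedBall c (2 * r))
    Metric.isClosed_closedBall fun x hx => h0 x fun h => hx (Metric.ball_subset_closedBall h)
  have hts : tsupport g ⊆ Metric.closedBall c (2 * r) :=
    closure_minimal (fun x hx => by_contra fun h => hx (h0 x fun h' =>
      h (Metric.ball_subset_closedBall h'))) Metric.isClosed_closedBall
  have hi : Integrable (fun x => ‖fderiv ℝ g x‖) :=
    ((hg.continuous_fderiv (by simp)).integrable_of_hasCompactSupport (hcs.fderiv ℝ)).norm
  refine ⟨hi, ?_⟩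
  have hfin : (volume : Measure 𝔼) (Metric.closedBall c (2 * r)) < ⊤ :=
    (isCompact_closedBall c (2 * r)).measure_lt_top
  rw [← setIntegral_eq_integral_of_forall_compl_eq_zero (s := Metric.closedBall c (2 * r))
    fun x hx => by
      rw [image_eq_zero_of_notMem_tsupport fun h => hx (hts (tsupport_fderiv_subset ℝ h)),
        norm_zero]]
  have h1 := setIntegral_mono_on hi.integrableOn (integrableOn_const hfin.ne)
    Metric.isClosed_closedBall.measurableSet fun x _ => hL x
  refine h1.trans (le_of_eq ?_)
  rw [setIntegral_const, Measure.real, Measure.addHaar_closedBall' _ _ (by positivity),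
    ENNReal.toReal_mul, finrank_euclideanSpace_fin, ENNReal.toReal_ofReal (by positivity),
    Real.rpow_sub_one hr.ne', Real.rpow_natCast, smul_eq_mul, mul_pow, Measure.real]
  ring

/-- Compact sets of vanishing `(n-1)`-dimensional Hausdorff measure have cutoff functions with
small gradient in `L¹`. -/
theorem exists_cutoff_integral_gradient_le (hn : 1 ≤ n) {K U : Set 𝔼} (hK : IsCompact K)
    (hU : IsOpen U) (hKU : K ⊆ U)
    (hK0 : (Measure.hausdorffMeasure ((n : ℝ) - 1) : Measure 𝔼) K = 0) {ε : ℝ} (hε : 0 < ε) :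
    ∃ ψ, IsTest U ψ ∧ (∀ x, ψ x ∈ Icc (0 : ℝ) 1) ∧ (∀ x ∈ K, ψ x = 1) ∧
      (∀ x ∉ Metric.thickening ε K, ψ x = 0) ∧ ∫ x, ‖gradient ψ x‖ ≤ ε := by
  obtain ⟨L, hL0, hL⟩ := exists_bump_gradient_le (n := n)
  obtain ⟨δ, hδ, hKδ⟩ := hK.exists_cthickening_subset_open hU hKU
  set M := L * 2 ^ n * (volume : Measure 𝔼).real (Metric.closedBall 0 1) with hM
  have hM0 : 0 ≤ M := by positivity
  have hn1 : (0 : ℝ) ≤ (n : ℝ) - 1 := by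
    rw [sub_nonneg]; exact_mod_cast hn
  obtain ⟨s, c, r, hcr, hKs, hsum⟩ := exists_finite_cover_of_hausdorffMeasure_eq_zero hn1 hK hK0
    -- The bounds keep the doubled balls within `U`, keep them within the `ε`-thickening of `K`, and
    -- make the gradient integral small, respectively.
    (show 0 < min (min (δ / 2) (ε / 2)) (ε / (M + 1)) by positivity)
  have hrδ : ∀ i ∈ s, 2 * r i ≤ δ := fun i hi => by
    have := (hcr i hi).2.2.trans ((min_le_left _ _).trans (min_le_left _ _)); linarith
  have hrε : ∀ i ∈ s, 2 * r i ≤ ε := fun i hi => by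
    have := (hcr i hi).2.2.trans ((min_le_left _ _).trans (min_le_right _ _)); linarith
  have hex : ∀ i, ∃ g : 𝔼 → ℝ, i ∈ s → ContDiff ℝ ∞ g ∧ (∀ x, g x ∈ Icc (0 : ℝ) 1) ∧
      (∀ x ∈ Metric.ball (c i) (r i), g x = 1) ∧
      (∀ x ∉ Metric.ball (c i) (2 * r i), g x = 0) ∧ ∀ x, ‖fderiv ℝ g x‖ ≤ L / r i := by
    intro i
    by_cases hi : i ∈ s
    · obtain ⟨g, hg⟩ := hL (c i) (r i) (hcr i hi).2.1
      exact ⟨g, fun _ => hg⟩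
    · exact ⟨0, fun h => absurd h hi⟩
  choose g hg using hex
  obtain ⟨p1, p2, p3⟩ := prod_one_sub_properties s (fun i hi => (hg i hi).1)
    (fun i hi => (hg i hi).2.1)
  set P : 𝔼 → ℝ := fun x => ∏ i ∈ s, (1 - g i x) with hP
  have hfar : ∀ x, (∀ i ∈ s, x ∉ Metric.ball (c i) (2 * r i)) → 1 - P x = 0 := by
    intro x hx
    rw [sub_eq_zero, hP]
    exact (Finset.prod_eq_one fun i hi => by rw [(hg i hi).2.2.2.1 x (hx i hi), sub_zero]).symm
  have hsupp : ∀ x ∉ Metric.cthickening δ K, 1 - P x = 0 := fun x hx =>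
    hfar x fun i hi h => hx (Metric.closedBall_subset_cthickening (hcr i hi).1 δ
      (Metric.closedBall_subset_closedBall (hrδ i hi) (Metric.ball_subset_closedBall h)))
  have hts : tsupport (fun x => 1 - P x) ⊆ Metric.cthickening δ K :=
    closure_minimal (fun x (hx : 1 - P x ≠ 0) => by_contra fun h => hx (hsupp x h))
      Metric.isClosed_cthickening
  refine ⟨fun x => 1 - P x, ⟨contDiff_const.sub p1, HasCompactSupport.intro' hK.cthickening
    Metric.isClosed_cthickening hsupp, hts.trans hKδ⟩, fun x => ?_, fun x hx => ?_,
    fun x hx => ?_, ?_⟩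
  · exact ⟨by linarith [(p2 x).2], by linarith [(p2 x).1]⟩
  · obtain ⟨i, hi, hxi⟩ := mem_iUnion₂.1 (hKs hx)
    have : P x = 0 := Finset.prod_eq_zero hi (by rw [(hg i hi).2.2.1 x hxi, sub_self])
    change 1 - P x = 1
    rw [this, sub_zero]
  · refine hfar x fun i hi h => hx (Metric.mem_thickening_iff.2 ⟨c i, (hcr i hi).1, ?_⟩)
    exact (Metric.mem_ball.1 h).trans_le (hrε i hi)
  · have hb := fun i hi => integral_norm_gradient_bump_le (hcr i hi).2.1 (hg i hi).1
      (hg i hi).2.2.2.1 (hg i hi).2.2.2.2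
    calc ∫ x, ‖gradient (fun x => 1 - P x) x‖
        ≤ ∫ x, ∑ i ∈ s, ‖fderiv ℝ (g i) x‖ := by
          refine integral_mono_of_nonneg (.of_forall fun x => norm_nonneg _)
            (integrable_finsetSum s fun i hi => (hb i hi).1) (.of_forall fun x => ?_)
          dsimp only
          rw [norm_gradient, fderiv_const_sub, norm_neg]
          exact p3 x
      _ = ∑ i ∈ s, ∫ x, ‖fderiv ℝ (g i) x‖ := integral_finsetSum s fun i hi => (hb i hi).1
      _ ≤ ∑ i ∈ s, M * r i ^ ((n : ℝ) - 1) := Finset.sum_le_sum fun i hi => (hb i hi).2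
      _ = M * ∑ i ∈ s, r i ^ ((n : ℝ) - 1) := by rw [Finset.mul_sum]
      _ ≤ M * (ε / (M + 1)) := mul_le_mul_of_nonneg_left (hsum.trans (min_le_right _ _)) hM0
      _ ≤ ε := by
          rw [mul_div_assoc', div_le_iff₀ (by positivity)]
          nlinarith

/-- The divergence of a bounded field vanishes on `(n-1)`-dimensional Hausdorff null sets. -/
theorem MemDM.variation_eq_zero_of_hausdorffMeasure (hn : 1 ≤ n) {U : Set 𝔼} (hU : IsOpen U)
    {F : 𝔼 → 𝔼} (hF : MemDM U ⊤ F) {A : Set 𝔼} (hA : MeasurableSet A) (hAU : A ⊆ U)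
    (hA0 : (Measure.hausdorffMeasure ((n : ℝ) - 1) : Measure 𝔼) A = 0) :
    (divMeasure U F).variation A = 0 := by
  obtain ⟨M, hM0, hM⟩ := hF.1.exists_ae_norm_le
  refine variation_eq_zero_of_isCompact _ hA fun K hKA hK => ?_
  refine apply_eq_zero_of_cutoffs _ hK fun ε hε => ?_
  obtain ⟨ψ, hψ, h01, h1, h0, hint⟩ := exists_cutoff_integral_gradient_le hn hK hU
    (hKA.trans hAU) (measure_mono_null hKA hA0) (show 0 < min ε (ε / (M + 1)) by positivity)
  refine ⟨ψ, hψ.1.continuous, h01, h1, fun x hx => h0 x fun h => hx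
    (Metric.thickening_mono (min_le_left _ _) K h), ?_⟩
  have hgi : Integrable (fun x => ‖gradient ψ x‖) :=
    (hψ.1.continuous_gradient.integrable_of_hasCompactSupport hψ.2.1.gradient).norm
  rw [← abs_neg, ← hF.isDivergence.2 ψ hψ]
  calc |∫ x in U, ⟪F x, gradient ψ x⟫| ≤ ∫ x in U, M * ‖gradient ψ x‖ := by
        rw [← Real.norm_eq_abs]
        refine norm_integral_le_of_norm_le (hgi.integrableOn.const_mul M) ?_
        filter_upwards [hM] with x hx
        exact (norm_inner_le_norm (𝕜 := ℝ) _ _).trans (mul_le_mul_of_nonneg_right hx (norm_nonneg _))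
    _ = M * ∫ x in U, ‖gradient ψ x‖ := integral_const_mul _ _
    _ ≤ M * ∫ x, ‖gradient ψ x‖ := mul_le_mul_of_nonneg_left
        (setIntegral_le_integral hgi (.of_forall fun x => norm_nonneg _)) hM0
    _ ≤ M * (ε / (M + 1)) := mul_le_mul_of_nonneg_left (hint.trans (min_le_right _ _)) hM0
    _ ≤ ε := by
        rw [mul_div_assoc', div_le_iff₀ (by positivity)]
        nlinarith

end Hausdorff

/-! ### Good approximations -/

section GoodApproximation

variable {n : ℕ}

local notation "𝔼" => EuclideanSpace ℝ (Fin n)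

variable {U Ω : Set (EuclideanSpace ℝ (Fin n))} {χ : EuclideanSpace ℝ (Fin n) → ℝ}
  {χs : ℕ → EuclideanSpace ℝ (Fin n) → ℝ}

/-- The extended distance also covers `S = ∅`, where it is infinite. -/
theorem eventually_coe_lt_infEDist {S : Set 𝔼} (hS : IsClosed S) {x : 𝔼} (hx : x ∉ S) :
    ∀ᶠ k : ℕ in atTop, ((1 / ((k : ℝ) + 1) : ℝ) : EReal) < (Metric.infEDist x S : EReal) := by
  have hpos : 0 < Metric.infEDist x S :=
    Metric.infEDist_pos_iff_notMem_closure.2 (by rwa [hS.closure_eq])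
  have hlim : Tendsto (fun k : ℕ => ENNReal.ofReal (1 / ((k : ℝ) + 1))) atTop (𝓝 0) := by
    simpa using ENNReal.tendsto_ofReal (tendsto_one_div_add_atTop_nhds_zero_nat (𝕜 := ℝ))
  filter_upwards [hlim.eventually (gt_mem_nhds hpos)] with k hk
  have h := EReal.coe_ennreal_lt_coe_ennreal_iff.2 hk
  rwa [EReal.coe_ennreal_ofReal, max_eq_left (by positivity)] at h

theorem IsGoodApproximation.mem_Icc_of_seq (hχ : IsGoodApproximation U Ω χ χs) (k : ℕ) (x : 𝔼) :
    χs k x ∈ Icc (0 : ℝ) 1 := by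
  by_cases hx : x ∈ U
  · exact hχ.seq_mem_Icc k x hx
  · rw [image_eq_zero_of_notMem_tsupport fun h => hx (hχ.seq_tsupport_subset k h)]
    exact ⟨le_rfl, zero_le_one⟩

theorem IsGoodApproximation.tendsto_interior (hχ : IsGoodApproximation U Ω χ χs) (hΩU : Ω ⊆ U)
    {x : 𝔼} (hx : x ∈ interior Ω) : Tendsto (fun k => χs k x) atTop (𝓝 1) := by
  have hxΩ := interior_subset hx
  refine tendsto_const_nhds.congr' ?_
  filter_upwards [eventually_coe_lt_infEDist isClosed_frontier fun h => h.2 hx] with k hk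
  refine (hχ.eq_one k x ⟨hΩU hxΩ, ?_⟩).symm
  rw [nbhd, mem_ofPred_eq, signedBdryDist, if_pos hxΩ, EReal.coe_neg, EReal.neg_lt_neg_iff]
  exact hk

theorem IsGoodApproximation.tendsto_exterior (hχ : IsGoodApproximation U Ω χ χs) {x : 𝔼}
    (hxU : x ∈ U) (hx : x ∉ closure Ω) : Tendsto (fun k => χs k x) atTop (𝓝 0) := by
  refine tendsto_const_nhds.congr' ?_
  filter_upwards [eventually_coe_lt_infEDist isClosed_frontier
    fun h => hx (frontier_subset_closure h)] with k hk
  refine (hχ.eq_zero k x ⟨hxU, fun h => ?_⟩).symm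
  rw [nbhd, mem_ofPred_eq, signedBdryDist, if_neg fun h => hx (subset_closure h)] at h
  exact lt_asymm h hk

theorem IsGoodApproximation.hausdorffMeasure_eq_zero (hχ : IsGoodApproximation U Ω χ χs)
    (hU : IsOpen U) : (Measure.hausdorffMeasure ((n : ℝ) - 1) : Measure 𝔼)
      {x | x ∈ U ∧ ¬Tendsto (fun k => χs k x) atTop (𝓝 (χ x))} = 0 := by
  have h := (ae_restrict_iff' hU.measurableSet).1 hχ.tendsto_ae
  rw [ae_iff] at h
  simpa only [Classical.not_imp] using h

/-! ### Integrability and the limit condition for normal measures. -/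

theorem VIntegrable.smul {ν : Fin n → FAMeasure 𝔼} (hν : IsBa U ν) (hU : MeasurableSet U)
    {F : 𝔼 → 𝔼} (hF : VIntegrable ν F) {φ : 𝔼 → ℝ} (hφ : MemLp φ ⊤ (volume.restrict U)) :
    VIntegrable ν fun x => φ x • F x := by
  obtain ⟨g, C, hg, hC, -, hφg⟩ := exists_bounded_measurable hU hφ
  intro j
  simpa using (hF j).bdd_mul (hν j).1 (hν j).2 hg hC hφg

theorem vIntegrable_of_memLp_top {ν : Fin n → FAMeasure 𝔼} (hν : IsBa U ν) (hU : MeasurableSet U)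
    {F : 𝔼 → 𝔼} (hF : MemLp F ⊤ (volume.restrict U)) : VIntegrable ν F := by
  intro j
  have hFj : MemLp (fun x => F x j) ⊤ (volume.restrict U) :=
    hF.of_le ((EuclideanSpace.proj (𝕜 := ℝ) j).continuous.comp_aestronglyMeasurable hF.1)
      (.of_forall fun x => PiLp.norm_apply_le (F x) j)
  obtain ⟨g, C, hg, hC, -, hFg⟩ := exists_bounded_measurable hU hFj
  simpa using (FAMeasure.integrable_one (hν j).1).bdd_mul (hν j).1 (hν j).2 hg hC hFg

/-- Evaluation at `φ F` is continuous for pointwise convergence, so it maps the cluster point to one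
of a real sequence. First countability of `ℝ` gives a subsequence, which depends on `φ`. -/
theorem IsNormalMeasure.limitCondition {ν : Fin n → FAMeasure 𝔼} (hν : IsNormalMeasure U χs ν)
    {F : 𝔼 → 𝔼} (hF : MemLp F ⊤ (volume.restrict U)) : LimitCondition U χs ν F := by
  intro φ hφ
  have hφF : MemLp (fun x => φ x • F x) ⊤ (volume.restrict U) := hF.smul hφ
  have h := hν.clusterPt.continuousAt_comp
    (continuous_apply (⟨_, hφF⟩ : {Φ : 𝔼 → 𝔼 // MemLp Φ ⊤ (volume.restrict U)})).continuousAt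
  obtain ⟨κ, hκ, hlim⟩ := h.tendsto_subseq
  refine ⟨κ, hκ, ?_⟩
  simpa [Function.comp_def] using hlim.neg

theorem IsGoodApproximation.tendstoAEBoundary (hn : 1 ≤ n) (hU : IsOpen U)
    (hχ : IsGoodApproximation U Ω χ χs) {F : 𝔼 → 𝔼} (hF : MemDM U ⊤ F) :
    TendstoAEBoundary U Ω χ χs F := by
  set N : Set 𝔼 := {x | x ∈ U ∧ ¬Tendsto (fun k => χs k x) atTop (𝓝 (χ x))} with hN
  obtain ⟨A, hNA, hA, hA0⟩ := exists_measurable_superset_of_null (hχ.hausdorffMeasure_eq_zero hU)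
  have h := hF.variation_eq_zero_of_hausdorffMeasure hn hU (hA.inter hU.measurableSet)
    inter_subset_right (measure_mono_null inter_subset_left hA0)
  rw [TendstoAEBoundary, ae_iff]
  refine measure_mono_null (fun x hx => ?_) h
  obtain ⟨h1, h2⟩ := Classical.not_imp.1 hx
  exact ⟨hNA ⟨h1.2, h2⟩, h1.2⟩

theorem IsGoodApproximation.tendsto_integral (hχ : IsGoodApproximation U Ω χ χs) (hU : IsOpen U)
    (hΩU : Ω ⊆ U) {σ : SignedMeasure 𝔼} (hσU : σ.variation Uᶜ = 0)
    (hσ : σ.variation {x | x ∈ frontier Ω ∩ U ∧ ¬Tendsto (fun k => χs k x) atTop (𝓝 (χ x))} = 0) :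
    Tendsto (fun k => ∫ᵛ x, χs k x ∂•σ) atTop
      (𝓝 ((∫ᵛ x in frontier Ω ∩ U, χ x ∂•σ) + σ (interior Ω))) := by
  have := isFiniteMeasure_variation σ
  set S := frontier Ω ∩ U with hS
  have hSm : MeasurableSet S := isClosed_frontier.measurableSet.inter hU.measurableSet
  have hIm : MeasurableSet (interior Ω) := isOpen_interior.measurableSet
  have hdisj : ∀ x ∈ interior Ω, x ∉ S := fun x hx h => h.1.2 hx
  set g : 𝔼 → ℝ := fun x => S.indicator χ x + (interior Ω).indicator (fun _ => 1) x with hg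
  have hlim : ∀ᵐ x ∂σ.variation, Tendsto (fun k => χs k x) atTop (𝓝 (g x)) := by
    have h0 : ∀ᵐ x ∂σ.variation, x ∈ U := by
      rw [ae_iff]; exact hσU
    have h1 : ∀ᵐ x ∂σ.variation, x ∈ S → Tendsto (fun k => χs k x) atTop (𝓝 (χ x)) := by
      rw [ae_iff]; simpa only [Classical.not_imp] using hσ
    filter_upwards [h0, h1] with x hxU hxS
    by_cases hi : x ∈ interior Ω
    · simpa [hg, hi, hdisj x hi] using hχ.tendsto_interior hΩU hi
    by_cases hf : x ∈ S
    · simpa [hg, hi, hf] using hxS hf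
    · simpa [hg, hi, hf] using hχ.tendsto_exterior hxU fun h => hf ⟨⟨h, hi⟩, hxU⟩
  -- `χ` is only Lebesgue measurable; its measurability for `|σ|` on `∂Ω ∩ U` comes from being an
  -- almost everywhere limit of continuous functions.
  have hgm : AEStronglyMeasurable g σ.variation :=
    aestronglyMeasurable_of_tendsto_ae atTop
      (fun k => (hχ.seq_continuous k).aestronglyMeasurable) hlim
  have hχi : σ.Integrable (S.indicator χ) := by
    refine integrable_of_bounded_signedMeasure σ (C := 1) ?_ fun x => ?_
    · have : S.indicator χ = S.indicator g := by
        ext x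
        by_cases hx : x ∈ S
        · have hi : x ∉ interior Ω := fun h => hdisj x h hx
          simp [hx, hg, hi]
        · simp [hx]
      rw [this]
      exact hgm.indicator hSm
    · by_cases hx : x ∈ S
      · rw [indicator_of_mem hx, abs_of_nonneg (hχ.mem_Icc x hx.2).1]
        exact (hχ.mem_Icc x hx.2).2
      · simp [hx]
  have hIi : σ.Integrable ((interior Ω).indicator fun _ => (1 : ℝ)) := by
    refine integrable_of_bounded_signedMeasure σ (C := 1)
      (measurable_const.indicator hIm).aestronglyMeasurable fun x => ?_
    by_cases hx : x ∈ interior Ω <;> simp [hx]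
  have h := VectorMeasure.tendsto_integral_filter_of_norm_le_const (μ := σ)
    (B := ContinuousLinearMap.lsmul ℝ ℝ)
    (.of_forall fun k => (hχ.seq_continuous k).aestronglyMeasurable)
    ⟨1, .of_forall fun k => .of_forall fun x => by
      rw [Real.norm_of_nonneg (hχ.mem_Icc_of_seq k x).1]; exact (hχ.mem_Icc_of_seq k x).2⟩ hlim
  rw [hg, VectorMeasure.integral_fun_add hχi hIi, VectorMeasure.integral_indicator hSm,
    VectorMeasure.integral_indicator hIm, VectorMeasure.integral_const,
    VectorMeasure.restrict_apply _ hIm .univ, univ_inter] at h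
  simpa using h

/-- The Gauss–Green formula for fields satisfying the limit condition. -/
theorem IsGoodApproximation.gaussGreen (hU : IsOpen U) (hΩU : Ω ⊆ U)
    (hχ : IsGoodApproximation U Ω χ χs) {ν : Fin n → FAMeasure 𝔼} (hν : IsNormalMeasure U χs ν)
    {F : 𝔼 → 𝔼} (hF : MemDM U 1 F) (hFν : VIntegrable ν F) (hlim : LimitCondition U χs ν F)
    (hbd : TendstoAEBoundary U Ω χ χs F) {φ : 𝔼 → ℝ} (hφ : MemW1Inf U φ) :
    MemDM U 1 (fun x => φ x • F x) ∧ VIntegrable ν (fun x => φ x • F x) ∧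
      (∫ᵛ x in frontier Ω ∩ U, χ x ∂•(divMeasure U fun x => φ x • F x))
          + divMeasure U (fun x => φ x • F x) (interior Ω)
        = vIntegral ν fun x => φ x • F x := by
  obtain ⟨μ', hμ', hac⟩ := hF.isDivergence.exists_smul hU hF.1 hφ
  have hH : MemDM U 1 (fun x => φ x • F x) := ⟨hF.1.smul hφ.1, μ', hμ'⟩
  refine ⟨hH, hFν.smul hν.isBa hU.measurableSet hφ.1, ?_⟩
  have hσ := hH.isDivergence
  -- `divMeasure` is an arbitrary choice; uniqueness transfers to it the absolute continuity of the
  -- measure built from the product rule.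
  have heq : μ' = divMeasure U (fun x => φ x • F x) := hμ'.unique hU hσ
  rw [heq] at hac
  obtain ⟨κ, hκ, hκlim⟩ := hlim φ hφ.1
  have hnull : (divMeasure U fun x => φ x • F x).variation
      {x | x ∈ frontier Ω ∩ U ∧ ¬Tendsto (fun k => χs k x) atTop (𝓝 (χ x))} = 0 := by
    refine hac _ ?_ ?_
    · rw [TendstoAEBoundary, ae_iff] at hbd
      simpa only [Classical.not_imp] using hbd
    · refine measure_mono_null ?_ (Measure.absolutelyContinuous_of_le Measure.restrict_le_self
        (volume_eq_zero_of_hausdorffMeasure_eq_zero (hχ.hausdorffMeasure_eq_zero hU)))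
      exact fun x hx => ⟨hx.1.2, hx.2⟩
  have hconv := (hχ.tendsto_integral hU hΩU hσ.1 hnull).comp hκ.tendsto_atTop
  refine neg_injective (tendsto_nhds_unique (hconv.neg.congr fun j => ?_) hκlim)
  exact (hσ.integral_inner_weakGradient hU hH.1 (hχ.seq_memW1Inf _) (hχ.seq_continuous _)
    (hχ.seq_hasCompactSupport _) (hχ.seq_tsupport_subset _)).symm

end GoodApproximation

end GaussGreen

end

theorem mainTheorem6 {n : ℕ} (hn : 1 ≤ n)
    (U Ω : Set (EuclideanSpace ℝ (Fin n)))
    (hU : IsOpen U) (hUb : Bornology.IsBounded U) (hΩ : MeasurableSet Ω) (hΩU : Ω ⊆ U)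
    (χ : EuclideanSpace ℝ (Fin n) → ℝ) (χs : ℕ → EuclideanSpace ℝ (Fin n) → ℝ)
    (hχ : IsGoodApproximation U Ω χ χs)
    (ν : Fin n → FAMeasure (EuclideanSpace ℝ (Fin n)))
    (hν : IsNormalMeasure U χs ν) :
    (∀ F : EuclideanSpace ℝ (Fin n) → EuclideanSpace ℝ (Fin n),
      MemDM U 1 F → VIntegrable ν F → LimitCondition U χs ν F → TendstoAEBoundary U Ω χ χs F →
      ∀ φ : EuclideanSpace ℝ (Fin n) → ℝ, MemW1Inf U φ →
        MemDM U 1 (fun x => φ x • F x) ∧ VIntegrable ν (fun x => φ x • F x) ∧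
        (∫ᵛ x in frontier Ω ∩ U, χ x ∂•(divMeasure U fun x => φ x • F x))
            + divMeasure U (fun x => φ x • F x) (interior Ω)
          = vIntegral ν fun x => φ x • F x) ∧
    (∀ F : EuclideanSpace ℝ (Fin n) → EuclideanSpace ℝ (Fin n),
      MemDM U ⊤ F →
      MemDM U 1 F ∧ VIntegrable ν F ∧ LimitCondition U χs ν F ∧ TendstoAEBoundary U Ω χ χs F ∧
      ∀ φ : EuclideanSpace ℝ (Fin n) → ℝ, MemW1Inf U φ →
        MemDM U 1 (fun x => φ x • F x) ∧ VIntegrable ν (fun x => φ x • F x) ∧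
        (∫ᵛ x in frontier Ω ∩ U, χ x ∂•(divMeasure U fun x => φ x • F x))
            + divMeasure U (fun x => φ x • F x) (interior Ω)
          = vIntegral ν fun x => φ x • F x) := by
  have part (F : EuclideanSpace ℝ (Fin n) → EuclideanSpace ℝ (Fin n)) (h1 : MemDM U 1 F)
      (h2 : VIntegrable ν F) (h3 : LimitCondition U χs ν F) (h4 : TendstoAEBoundary U Ω χ χs F)
      (φ : EuclideanSpace ℝ (Fin n) → ℝ) (hφ : MemW1Inf U φ) :=
    hχ.gaussGreen hU hΩU hν h1 h2 h3 h4 hφ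
  refine ⟨part, fun F hF => ?_⟩
  -- Boundedness of `U` gives the inclusion of `L^∞` in `L¹`.
  have : IsFiniteMeasure (volume.restrict U) := ⟨by
    rw [Measure.restrict_apply_univ]; exact hUb.measure_lt_top⟩
  have h1 : MemDM U 1 F := ⟨hF.1.mono_exponent le_top, hF.2⟩
  have h2 := vIntegrable_of_memLp_top hν.isBa hU.measurableSet hF.1
  have h3 := hν.limitCondition hF.1
  have h4 := hχ.tendstoAEBoundary hn hU hF
  exact ⟨h1, h2, h3, h4, part F h1 h2 h3 h4⟩
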